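/- **Setting.** Let $A\subseteq B$ be a Prüfer extension of commutative rings (with $1$), i.e. for every $x\in B$ there is $y\in A$ with $xy\in A$ and $x(1-xy)\in A$; equivalently, every ring between $A$ and $B$ is integrally closed in $B$. Let $\Lambda$ be the group of invertible $A$-submodules of $B$, with neutral element $A$, ordered by reverse inclusion; it is an abelian $l$-group with $\alpha\wedge\beta=\alpha+\beta$ and $\alpha\vee\beta=\alpha\cap\beta$. The *residue structure* is the disjoint union $R=R_{B/A}=\bigsqcup_{\alpha\in\Lambda}B/\alpha$. For $\mathbf x=x \bmod \alpha$ put $v(\mathbf x)=\alpha+Ax\in\Lambda$. The operations are $$(x \bmod \alpha)+(y \bmod \beta)=(x+y) \bmod (\alpha+\beta),\qquad -(x \bmod \alpha)=(-x) \bmod \alpha,$$ $$\mathbf x\bullet\mathbf y=xy \bmod \bigl(\alpha v(\mathbf y)+\beta v(\mathbf x)\bigr)\quad(\mathbf x=x \bmod \alpha,\ \mathbf y=y \bmod \beta),\qquad \varepsilon=0 \bmod A,$$ $$\mathbf x^{-1}=z \bmod \alpha v(\mathbf x)^{-2},\quad\text{where } z\in v(\mathbf x)^{-1},\ xz\equiv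 1 \bmod v(\mathbf x)^{-1}\alpha .$$ **Definitions.** Let $(R,+,\bullet,-,{}^{-1},\varepsilon)$ be an algebra of signature $(2,2,1,1,0)$. Put $e^+(x)=x+(-x)$, $E^+=\{x: x+x=x\}$, $E^\bullet=\{x: x\bullet x=x\}$, $v(x)=\varepsilon\bullet x$, and $x\le y$ iff $x=y+e^+(x)$. * $R$ is a *commutative regular quasi-semiring* (cr-qsring) if $(R,+)$ and $(R,\bullet)$ are commutative regular semigroups with quasi-inverses $-x$, $x^{-1}$ (that is, $x+x+(-x)=x$, $(-x)+(-x)+x=-x$, and likewise for $\bullet$, ${}^{-1}$); $E^+\cap E^\bullet=\{\varepsilon\}$; $x\bullet y+x\bullet z\le x\bullet(y+z)$; $y\le z$ implies $x\bullet y\le x\bullet z$; $-(x\bullet y)=x\bullet(-y)$; and $e^+(x+y)\le e^+(x\bullet y)$ for $x,y\in E^\bullet$. Then $E^+$ is an abelian $l$-group under $\bullet$ with meet $+$; denote it by $\Lambda$, and put $\Lambda_+=\{\alpha\in\Lambda:\alpha\ge\varepsilon\}$. * $R$ is *directed* if $\varepsilon\le x$ for all $x\in E^\bullet$; then any $x,y\in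 R$ have a greatest lower bound $x\wedge y$. A directed $R$ is *superrigid* if $e^+$ maps $E^\bullet$ onto $\Lambda_+$. * $R$ is *complete* if for every $x\in R$ there is an order-preserving map $\varphi:\Lambda\to R$ with $e^+(\varphi(\alpha))=\alpha$ for all $\alpha$ and $\varphi(e^+(x))=x$. * For $R$ superrigid and directed, let $B(R)$ be the inverse limit of the groups $R_\alpha=\{x: e^+(x)=\alpha\}$, $\alpha\in\Lambda_+$: its elements are the order-preserving maps $\varphi:\Lambda_+\to R$ with $e^+(\varphi(\alpha))=\alpha$. It is a commutative ring under pointwise addition and the product $(\varphi\psi)(\alpha)=\varphi(\gamma)\bullet\psi(\gamma)+\alpha$ for all sufficiently large $\gamma\in\Lambda_+$. Let $w(\varphi)=v\circ\varphi$, a map $\Lambda_+\to\Lambda$, and let $A_w=\{\varphi\in B(R): w(\varphi)(\alpha)\ge\varepsilon\text{ for all }\alpha\}$. For a finitely generated $A_w$-submodule $I$ of $B(R)$ with generators $\varphi_1,\dots,\varphi_n$ put $\widehat w(I)(\alpha)=\alpha\wedge w(\varphi_1)(\alpha)\wedge\dots\wedge w(\varphi_n)(\alpha)$. Let $M$ be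 the monoid of finitely generated $A_w$-submodules of $B(R)$ and $M^*$ its group of invertible elements. Maps $f,g:\Lambda_+\to\Lambda$ of the form $\widehat w(I)$ are multiplied by $(fg)(\alpha)=(f(\gamma)g(\gamma))\wedge\alpha$ for all sufficiently large $\gamma\in\Lambda_+$; $\widehat w(M)^*$ denotes the group of invertible elements of $\widehat w(M)$, and $\Lambda$ is identified with the set of maps $\alpha\mapsto\gamma\wedge\alpha$, $\gamma\in\Lambda$. $R$ is *Prüfer–Manis in the strong sense* if $A_w\subseteq B(R)$ is a Prüfer extension, $\widehat w(M)^*=\Lambda$, and $\widehat w$ restricts to an isomorphism $M^*\to\widehat w(M)^*$. * For $R$ directed, put $d(x,y)=e^+(x)\bullet e^+(y)\bullet e^+(x\wedge y)^{-2}$ and $[x,y]=\{z: x\wedge y\le z \text{ and } z \text{ is the least upper bound of } x\wedge z \text{ and } y\wedge z\}$. $R$ is *locally faithfully full* (lff) if for all $x,y$ the map $z\mapsto d(x,z)$ is a bijection from $[x,y]$ onto $\{\gamma\in\Lambda:\varepsilon\le\gamma\le d(x,y)\}$. $R$ is *median* if for all $x,y,z$ the set $[x,y]\cap[y,z]\cap[z,x]$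 has exactly one element, the median $m(x,y,z)$. **Lemma.** The residue structure $R=R_{B/A}$ is a superrigid directed cr-qsring. It is complete and Prüfer–Manis in the strong sense. It is lff and median. Moreover, for $\mathbf x_i=x_i \bmod \alpha_i$ ($i=1,2,3$), the submodule $$\alpha=\bigcap_{1\le i<j\le 3}\bigl(\alpha_i+\alpha_j+A(x_i-x_j)\bigr)$$ is invertible, there is $x\in B$ such that $$x\equiv x_i\equiv x_j \bmod \bigl(\alpha_i+\alpha_j+A(x_i-x_j)\bigr)\qquad(1\le i<j\le 3),$$ these congruences determine $x$ exactly modulo $\alpha$ (an element $y\in B$ satisfies them if and only if $y\equiv x \bmod \alpha$), and $$m(\mathbf x_1,\mathbf x_2,\mathbf x_3)=\bigvee_{1\le i<j\le 3}(\mathbf x_i\wedge\mathbf x_j)=x \bmod \alpha .$$ -/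

import Mathlib

/-! ### Prüfer extensions and the group of invertible submodules -/

/-- The extension of commutative rings `A ⊆ B` is a *Prüfer extension*: for every `x ∈ B` there is
`y ∈ A` with `x y ∈ A` and `x (1 - x y) ∈ A`. (Equivalently, every ring between `A` and `B` is
integrally closed in `B`; equivalently, every finitely generated `A`-submodule `I` of `B` with
`I B = B` is invertible.) -/
class IsPruferExtension {B : Type*} [CommRing B] (A : Subring B) : Prop where
  exists_mem : ∀ x : B, ∃ y ∈ A, x * y ∈ A ∧ x * (1 - x * y) ∈ A

section Prufer

variable {B : Type*} [CommRing B] {A : Subring B}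

theorem mem_one_iff_mem {x : B} : x ∈ (1 : Submodule A B) ↔ x ∈ A := by
  rw [Submodule.mem_one]
  constructor
  · rintro ⟨y, rfl⟩
    exact y.2
  · intro h
    exact ⟨⟨x, h⟩, rfl⟩

/-- The local form of the divisibility property of a Prüfer extension. -/
theorem IsPruferExtension.exists_local [IsPruferExtension A] (m : Ideal A) (hm : m.IsMaximal)
    (w : B) : (∃ s : A, s ∉ m ∧ (s : B) * w ∈ A) ∨ (∃ y u : A, u ∉ m ∧ (u : B) = w * y) := by
  obtain ⟨y, hy, h1, h2⟩ := IsPruferExtension.exists_mem (A := A) w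
  by_cases h : (⟨w * y, h1⟩ : A) ∈ m
  · left
    refine ⟨1 - ⟨w * y, h1⟩, ?_, ?_⟩
    · intro h'
      apply hm.ne_top
      rw [Ideal.eq_top_iff_one]
      have := m.add_mem h' h
      simpa using this
    · simpa [mul_comm] using h2
  · exact Or.inr ⟨⟨y, hy⟩, ⟨w * y, h1⟩, h, rfl⟩

theorem IsPruferExtension.exists_denominator [IsPruferExtension A] (m : Ideal A)
    (hm : m.IsMaximal) (S : Set B) (hS : S.Finite) :
    ∃ j ∈ A, (∀ g ∈ S, j * g ∈ A) ∧ ∃ g ∈ insert 1 S, ∃ u : A, u ∉ m ∧ (u : B) = j * g := by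
  induction S, hS using Set.Finite.induction_on with
  | empty =>
    refine ⟨1, A.one_mem, by simp, 1, by simp, 1, ?_, by simp⟩
    intro h
    exact hm.ne_top ((Ideal.eq_top_iff_one _).2 h)
  | @insert x S _ _ ih =>
    obtain ⟨j, hj, hjS, g, hg, u, hu, hug⟩ := ih
    have hp : m.IsPrime := hm.isPrime
    rcases IsPruferExtension.exists_local m hm (x * j) with ⟨s, hs, hsw⟩ | ⟨y, u', hu', huw⟩
    · refine ⟨s * j, A.mul_mem s.2 hj, ?_, g, ?_, s * u, ?_, ?_⟩
      · rintro z (rfl | hz)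
        · have : (s : B) * j * z = s * (z * j) := by ring
          rwa [this]
        · rw [mul_assoc]
          exact A.mul_mem s.2 (hjS z hz)
      · rcases hg with rfl | hg
        · simp
        · simp [hg]
      · intro h
        exact (hp.mem_or_mem h).elim hs hu
      · push_cast
        rw [hug]
        ring
    · refine ⟨y * j, A.mul_mem y.2 hj, ?_, x, by simp, u', hu', by rw [huw]; ring⟩
      rintro z (rfl | hz)
      · have : (y : B) * j * z = z * j * y := by ring
        rw [this, ← huw]
        exact u'.2
      · rw [mul_assoc]
        exact A.mul_mem y.2 (hjS z hz)

theorem IsPruferExtension.isUnit_of_fg [IsPruferExtension A] {I : Submodule A B} (hI : I.FG)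
    (h1 : (1 : B) ∈ I) : IsUnit I := by
  obtain ⟨S, hS, rfl⟩ := Submodule.fg_def.1 hI
  set I := Submodule.span A S with hIdef
  have hJ : (1 / I : Submodule A B) * I ≤ 1 := Submodule.le_div_iff_mul_le.1 le_rfl
  have key : (1 : B) ∈ (1 / I : Submodule A B) * I := by
    let a : Ideal A := ((1 / I : Submodule A B) * I).comap (Algebra.linearMap A B)
    by_contra hne
    have ha : a ≠ ⊤ := by
      intro h
      have h2 : (1 : A) ∈ a := by rw [h]; trivial
      exact hne (by simpa [a] using h2)
    obtain ⟨m, hm, ham⟩ := Ideal.exists_le_maximal a ha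
    obtain ⟨j, hj, hjS, g, hg, u, hu, hug⟩ := IsPruferExtension.exists_denominator m hm S hS
    have hjI : j ∈ (1 / I : Submodule A B) := by
      rw [Submodule.mem_div_iff_forall_mul_mem]
      intro y hy
      induction hy using Submodule.span_induction with
      | mem x hx => exact mem_one_iff_mem.2 (hjS x hx)
      | zero => simp
      | add x y _ _ hx hy => rw [mul_add]; exact Submodule.add_mem _ hx hy
      | smul c x _ hx => rw [mul_smul_comm]; exact Submodule.smul_mem _ _ hx
    have hgI : g ∈ I := by
      rcases hg with rfl | hg
      · exact h1
      · exact Submodule.subset_span hg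
    apply hu
    apply ham
    change (u : B) ∈ (1 / I : Submodule A B) * I
    rw [hug]
    exact Submodule.mul_mem_mul hjI hgI
  have : (1 / I : Submodule A B) * I = 1 := le_antisymm hJ (Submodule.one_le.2 key)
  exact IsUnit.of_mul_eq_one (1 / I) (by rw [mul_comm]; exact this)

theorem IsPruferExtension.isUnit_sup [IsPruferExtension A] (α : (Submodule A B)ˣ)
    {N : Submodule A B} (hN : N.FG) : IsUnit ((α : Submodule A B) ⊔ N) := by
  have h : (α : Submodule A B) ⊔ N =
      α * ((1 : Submodule A B) ⊔ ((α⁻¹ : (Submodule A B)ˣ) : Submodule A B) * N) := by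
    rw [Submodule.mul_sup, mul_one, ← mul_assoc, Units.mul_inv, one_mul]
  rw [h]
  apply α.isUnit.mul
  apply IsPruferExtension.isUnit_of_fg
  · exact Submodule.FG.sup (Submodule.fg_unit 1) ((Submodule.fg_unit α⁻¹).mul hN)
  · exact Submodule.mem_sup_left (Submodule.one_le.1 le_rfl)

/-- For a Prüfer extension, the invertible submodule `α + N`, where `α` is invertible and `N` is
finitely generated. -/
noncomputable def addFG [IsPruferExtension A] (α : (Submodule A B)ˣ) (N : Submodule A B)
    (hN : N.FG) : (Submodule A B)ˣ :=
  (IsPruferExtension.isUnit_sup α hN).unit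

@[simp] theorem coe_addFG [IsPruferExtension A] (α : (Submodule A B)ˣ) (N : Submodule A B)
    (hN : N.FG) : ((addFG α N hN : (Submodule A B)ˣ) : Submodule A B) = (α : Submodule A B) ⊔ N :=
  rfl

/-- The meet `α ∧ β = α + β` in the `l`-group of invertible submodules (which is ordered by
reverse inclusion). -/
noncomputable def addInv [IsPruferExtension A] (α β : (Submodule A B)ˣ) : (Submodule A B)ˣ :=
  addFG α β (Submodule.fg_unit β)

/-- The invertible submodule `α + A x`. -/
noncomputable def addGen [IsPruferExtension A] (α : (Submodule A B)ˣ) (x : B) :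
    (Submodule A B)ˣ :=
  addFG α (Submodule.span A {x}) (Submodule.fg_span_singleton x)

@[simp] theorem coe_addInv [IsPruferExtension A] (α β : (Submodule A B)ˣ) :
    ((addInv α β : (Submodule A B)ˣ) : Submodule A B) = (α : Submodule A B) ⊔ β :=
  rfl

@[simp] theorem coe_addGen [IsPruferExtension A] (α : (Submodule A B)ˣ) (x : B) :
    ((addGen α x : (Submodule A B)ˣ) : Submodule A B) =
      (α : Submodule A B) ⊔ Submodule.span A {x} :=
  rfl

end Prufer

/-! ### Commutative regular quasi-semirings -/

/-- Algebras `(R, +, •, -, ⁻¹, ε)` of signature `(2, 2, 1, 1, 0)`, without axioms. -/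
class QOps (R : Type*) extends Add R, Mul R, Neg R, Inv R where
  eps : R

section Ops

variable {R : Type*} [QOps R]

/-- The constant `ε`. -/
abbrev eps : R := QOps.eps

/-- `e⁺(x) = x + (-x)`. -/
def ep (x : R) : R := x + -x

/-- `e•(x) = x • x⁻¹`. -/
def eb (x : R) : R := x * x⁻¹

/-- `v(x) = ε • x`. -/
def qv (x : R) : R := eps * x

/-- The canonical order of `(R, +)`: `x ≤ y` iff `x = y + e⁺(x)`. -/
def QLe (x y : R) : Prop := x = y + ep x

end Ops

infix:50 " ⊴ " => QLe

/-- Commutative regular quasi-semirings (cr-qsrings). -/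
class IsQSring (R : Type*) [QOps R] : Prop where
  add_comm : ∀ x y : R, x + y = y + x
  add_assoc : ∀ x y z : R, x + y + z = x + (y + z)
  add_add_neg : ∀ x : R, x + x + -x = x
  neg_neg_add : ∀ x : R, -x + -x + x = -x
  mul_comm : ∀ x y : R, x * y = y * x
  mul_assoc : ∀ x y z : R, x * y * z = x * (y * z)
  mul_mul_inv : ∀ x : R, x * x * x⁻¹ = x
  inv_inv_mul : ∀ x : R, x⁻¹ * x⁻¹ * x = x⁻¹
  /-- `E⁺ ∩ E• = {ε}` -/
  idem_iff : ∀ x : R, (x + x = x ∧ x * x = x) ↔ x = eps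
  quasi_distrib : ∀ x y z : R, x * y + x * z ⊴ x * (y + z)
  mul_mono : ∀ x y z : R, y ⊴ z → x * y ⊴ x * z
  neg_mul : ∀ x y : R, -(x * y) = x * -y
  ep_add_le : ∀ x y : R, x * x = x → y * y = y → ep (x + y) ⊴ ep (x * y)

/-- Directed cr-qsrings: `ε ≤ x` for all `x ∈ E•`. -/
class IsDirectedQSring (R : Type*) [QOps R] : Prop extends IsQSring R where
  eps_le : ∀ x : R, x * x = x → eps ⊴ x

/-- Superrigid directed cr-qsrings: the map `e⁺ : E• → Λ₊` is onto, where `Λ₊` is the set of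
the `α ∈ E⁺` with `ε ≤ α`. -/
class IsSuperrigidQSring (R : Type*) [QOps R] : Prop extends IsDirectedQSring R where
  exists_one : ∀ α : R, α + α = α → eps ⊴ α → ∃ x : R, x * x = x ∧ ep x = α

namespace QS

section QSring

variable {R : Type*} [QOps R] [IsQSring R]

instance : Std.Commutative (α := R) (· + ·) := ⟨IsQSring.add_comm⟩
instance : Std.Associative (α := R) (· + ·) := ⟨IsQSring.add_assoc⟩
instance : Std.Commutative (α := R) (· * ·) := ⟨IsQSring.mul_comm⟩
instance : Std.Associative (α := R) (· * ·) := ⟨IsQSring.mul_assoc⟩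

theorem neg_unique {x y : R} (h1 : x + x + y = x) (h2 : y + y + x = y) : y = -x := by
  have h3 := IsQSring.add_add_neg x
  have h4 := IsQSring.neg_neg_add x
  calc y = y + y + x := h2.symm
    _ = y + y + (x + x + -x) := by rw [h3]
    _ = (x + x + y) + y + -x := by ac_rfl
    _ = x + y + -x := by rw [h1]
    _ = x + y + (-x + -x + x) := by rw [h4]
    _ = (x + x + y) + -x + -x := by ac_rfl
    _ = -x + -x + x := by rw [h1]; ac_rfl
    _ = -x := h4

theorem inv_unique {x y : R} (h1 : x * x * y = x) (h2 : y * y * x = y) : y = x⁻¹ := by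
  have h3 := IsQSring.mul_mul_inv x
  have h4 := IsQSring.inv_inv_mul x
  calc y = y * y * x := h2.symm
    _ = y * y * (x * x * x⁻¹) := by rw [h3]
    _ = (x * x * y) * y * x⁻¹ := by ac_rfl
    _ = x * y * x⁻¹ := by rw [h1]
    _ = x * y * (x⁻¹ * x⁻¹ * x) := by rw [h4]
    _ = (x * x * y) * x⁻¹ * x⁻¹ := by ac_rfl
    _ = x⁻¹ * x⁻¹ * x := by rw [h1]; ac_rfl
    _ = x⁻¹ := h4

theorem neg_add' (x y : R) : -(x + y) = -x + -y := by
  symm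
  apply neg_unique
  · calc x + y + (x + y) + (-x + -y) = (x + x + -x) + (y + y + -y) := by ac_rfl
      _ = x + y := by rw [IsQSring.add_add_neg, IsQSring.add_add_neg]
  · calc -x + -y + (-x + -y) + (x + y) = (-x + -x + x) + (-y + -y + y) := by ac_rfl
      _ = -x + -y := by rw [IsQSring.neg_neg_add, IsQSring.neg_neg_add]

theorem mul_inv' (x y : R) : (x * y)⁻¹ = x⁻¹ * y⁻¹ := by
  symm
  apply inv_unique
  · calc x * y * (x * y) * (x⁻¹ * y⁻¹) = (x * x * x⁻¹) * (y * y * y⁻¹) := by ac_rfl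
      _ = x * y := by rw [IsQSring.mul_mul_inv, IsQSring.mul_mul_inv]
  · calc x⁻¹ * y⁻¹ * (x⁻¹ * y⁻¹) * (x * y) = (x⁻¹ * x⁻¹ * x) * (y⁻¹ * y⁻¹ * y) := by ac_rfl
      _ = x⁻¹ * y⁻¹ := by rw [IsQSring.inv_inv_mul, IsQSring.inv_inv_mul]

theorem neg_idem {f : R} (hf : f + f = f) : -f = f :=
  (neg_unique (by rw [hf, hf]) (by rw [hf, hf])).symm

theorem ep_of_idem {f : R} (hf : f + f = f) : ep f = f := by rw [ep, neg_idem hf, hf]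

theorem add_ep (x : R) : x + ep x = x := by
  rw [ep, ← IsQSring.add_assoc, IsQSring.add_add_neg]

theorem ep_idem (x : R) : ep x + ep x = ep x := by
  calc ep x + ep x = (x + x + -x) + -x := by unfold ep; ac_rfl
    _ = ep x := by rw [IsQSring.add_add_neg]; rfl

theorem ep_ep (x : R) : ep (ep x) = ep x := ep_of_idem (ep_idem x)

theorem ep_add (x y : R) : ep (x + y) = ep x + ep y := by
  rw [ep, neg_add', ep, ep]
  ac_rfl

theorem ep_neg (x : R) : ep (-x) = ep x := by
  have : - -x = x := (neg_unique (IsQSring.neg_neg_add x) (IsQSring.add_add_neg x)).symm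
  rw [ep, this, ep]
  ac_rfl

theorem add_idem {f g : R} (hf : f + f = f) (hg : g + g = g) : f + g + (f + g) = f + g := by
  calc f + g + (f + g) = (f + f) + (g + g) := by ac_rfl
    _ = f + g := by rw [hf, hg]

theorem le_refl (x : R) : x ⊴ x := (add_ep x).symm

theorem ep_eq_of_le {x y : R} (h : x ⊴ y) : ep x = ep y + ep x := by
  have := congrArg ep h
  rwa [ep_add, ep_ep] at this

theorem le_trans {x y z : R} (h1 : x ⊴ y) (h2 : y ⊴ z) : x ⊴ z := by
  have h3 := ep_eq_of_le h1
  unfold QLe at *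
  calc x = y + ep x := h1
    _ = z + ep y + ep x := by rw [← h2]
    _ = z + ep x := by rw [IsQSring.add_assoc, ← h3]

theorem le_of_add {x y f : R} (hf : f + f = f) (h : x = y + f) : x ⊴ y := by
  unfold QLe
  have : ep x = ep y + f := by rw [h, ep_add, ep_of_idem hf]
  rw [this, ← IsQSring.add_assoc, add_ep, h]

theorem add_idem_le (x : R) {f : R} (hf : f + f = f) : x + f ⊴ x := le_of_add hf rfl

theorem eq_of_le_of_ep {x y : R} (h : x ⊴ y) (h' : ep x = ep y) : x = y := by
  unfold QLe at h
  rw [h, h', add_ep]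

theorem ep_mono {x y : R} (h : x ⊴ y) : ep x ⊴ ep y := by
  unfold QLe
  rw [ep_ep, ← ep_eq_of_le h]

theorem add_le_add {x y z t : R} (h1 : x ⊴ y) (h2 : z ⊴ t) : x + z ⊴ y + t := by
  unfold QLe at *
  rw [ep_add]
  calc x + z = (y + ep x) + (t + ep z) := by rw [← h1, ← h2]
    _ = _ := by ac_rfl

theorem neg_le_neg {x y : R} (h : x ⊴ y) : -x ⊴ -y := by
  unfold QLe at *
  rw [ep_neg]
  conv_lhs => rw [h, neg_add', neg_idem (ep_idem x)]

theorem le_antisymm {x y : R} (h1 : x ⊴ y) (h2 : y ⊴ x) : x = y := by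
  apply eq_of_le_of_ep h1
  have h3 := ep_eq_of_le h1
  have h4 := ep_eq_of_le h2
  rw [h3]
  conv_rhs => rw [h4]
  ac_rfl

/-- Truncation: if `x ≤ y` and `α ≤ e⁺(x)`, then `x` and `y` agree modulo `α`. -/
theorem trunc {x y α : R} (hα : α + α = α) (h : x ⊴ y) (h' : α ⊴ ep x) : x + α = y + α := by
  unfold QLe at h h'
  rw [ep_of_idem hα] at h'
  calc x + α = y + ep x + α := by rw [← h]
    _ = y + (ep x + α) := by ac_rfl
    _ = y + α := by rw [← h']

theorem le_ep_idem {f g : R} (hf : f + f = f) : f ⊴ g ↔ f = g + f := by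
  unfold QLe
  rw [ep_of_idem hf]

theorem le_add {f g h : R} (h1 : f ⊴ g) (h2 : f ⊴ h) : f + f ⊴ g + h := add_le_add h1 h2

theorem mul_le_mul {x y z t : R} (h1 : x ⊴ y) (h2 : z ⊴ t) : x * z ⊴ y * t := by
  apply le_trans (IsQSring.mul_mono x z t h2)
  rw [IsQSring.mul_comm x t, IsQSring.mul_comm y t]
  exact IsQSring.mul_mono t x y h1

theorem eps_add : (eps : R) + eps = eps := ((IsQSring.idem_iff _).2 rfl).1
theorem eps_mul : (eps : R) * eps = eps := ((IsQSring.idem_iff _).2 rfl).2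

theorem mul_idem (x : R) {f : R} (hf : f + f = f) : x * f + x * f = x * f := by
  have h := IsQSring.quasi_distrib x f f
  rw [hf] at h
  unfold QLe at h
  rw [ep_add] at h
  calc x * f + x * f = x * f + (ep (x * f) + ep (x * f)) := h
    _ = x * f := by rw [ep_idem, add_ep]

theorem eb_idem (x : R) : eb x * eb x = eb x := by
  calc eb x * eb x = (x * x * x⁻¹) * x⁻¹ := by unfold eb; ac_rfl
    _ = eb x := by rw [IsQSring.mul_mul_inv]; rfl

theorem mul_eb (x : R) : x * eb x = x := by
  rw [eb, ← IsQSring.mul_assoc, IsQSring.mul_mul_inv]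

theorem eb_of_idem {f : R} (hf : f + f = f) : eb f = eps := by
  apply (IsQSring.idem_iff _).1
  refine ⟨?_, eb_idem f⟩
  rw [eb, IsQSring.mul_comm]
  exact mul_idem _ hf

theorem mul_eps_of_idem {f : R} (hf : f + f = f) : f * eps = f := by
  rw [← eb_of_idem hf, mul_eb]

theorem eps_mul_of_idem {f : R} (hf : f + f = f) : eps * f = f := by
  rw [IsQSring.mul_comm, mul_eps_of_idem hf]

theorem inv_idem {f : R} (hf : f + f = f) : f⁻¹ + f⁻¹ = f⁻¹ := by
  have h : f⁻¹ = f⁻¹ * eps := by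
    rw [← eb_of_idem hf, eb]
    calc f⁻¹ = f⁻¹ * f⁻¹ * f := (IsQSring.inv_inv_mul f).symm
      _ = _ := by ac_rfl
  rw [h]
  exact mul_idem _ eps_add

theorem mul_inv_of_idem {f : R} (hf : f + f = f) : f * f⁻¹ = eps := eb_of_idem hf

theorem qv_idem (x : R) : qv x + qv x = qv x := by
  rw [qv, IsQSring.mul_comm]
  exact mul_idem _ eps_add

theorem qv_of_idem {f : R} (hf : f + f = f) : qv f = f := eps_mul_of_idem hf

theorem qv_mul (x y : R) : qv (x * y) = qv x * qv y := by
  calc qv (x * y) = eps * eps * (x * y) := by rw [eps_mul]; rfl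
    _ = _ := by unfold qv; ac_rfl

theorem qv_mono {x y : R} (h : x ⊴ y) : qv x ⊴ qv y := IsQSring.mul_mono _ _ _ h

theorem qv_neg (x : R) : qv (-x) = qv x := by
  unfold qv
  rw [← IsQSring.neg_mul]
  exact neg_idem (qv_idem x)

theorem qv_add_le (x y : R) : qv x + qv y ⊴ qv (x + y) := IsQSring.quasi_distrib _ _ _

theorem qv_le_ep (x : R) : qv x ⊴ ep x := by
  have h := qv_add_le x (-x)
  rw [qv_neg, qv_idem] at h
  rwa [show x + -x = ep x from rfl, qv_of_idem (ep_idem x)] at h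

theorem mul_of_idem (x : R) {f : R} (hf : f + f = f) : x * f = qv x * f := by
  calc x * f = x * (eps * f) := by rw [eps_mul_of_idem hf]
    _ = _ := by unfold qv; ac_rfl

theorem qv_of_mul_idem {x : R} (hx : x * x = x) : qv x = eps :=
  (IsQSring.idem_iff _).1 ⟨qv_idem x, by rw [← qv_mul, hx]⟩

theorem ep_mul_le (x y : R) : ep (x * y) ⊴ qv x * ep y := by
  rw [← mul_of_idem x (ep_idem y)]
  unfold ep
  rw [IsQSring.neg_mul]
  exact IsQSring.quasi_distrib _ _ _

theorem le_inf {f g h : R} (hf : f + f = f) (h1 : f ⊴ g) (h2 : f ⊴ h) : f ⊴ g + h := by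
  have := add_le_add h1 h2
  rwa [hf] at this

theorem ep_mul_of_idem {x y : R} (hx : x * x = x) (hy : y * y = y) :
    ep (x * y) = ep x + ep y := by
  have h1 : ep (x * y) ⊴ ep y := by
    have := ep_mul_le x y
    rwa [qv_of_mul_idem hx, eps_mul_of_idem (ep_idem y)] at this
  have h2 : ep (x * y) ⊴ ep x := by
    have := ep_mul_le y x
    rwa [qv_of_mul_idem hy, eps_mul_of_idem (ep_idem x), IsQSring.mul_comm] at this
  apply le_antisymm (le_inf (ep_idem _) h2 h1)
  rw [← ep_add]
  exact IsQSring.ep_add_le x y hx hy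

theorem qv_inv (x : R) : qv x * qv x⁻¹ = eps := by
  rw [← qv_mul]
  exact qv_of_mul_idem (eb_idem x)

theorem ep_eq (x : R) : ep x = qv x * ep (eb x) := by
  apply le_antisymm
  · have h := ep_mul_le x (eb x)
    rwa [mul_eb] at h
  · have h := ep_mul_le x⁻¹ x
    rw [IsQSring.mul_comm x⁻¹ x, show x * x⁻¹ = eb x from rfl] at h
    have h' := IsQSring.mul_mono (qv x) _ _ h
    rwa [← IsQSring.mul_assoc, qv_inv, eps_mul_of_idem (ep_idem x)] at h'

theorem distrib_idem (x : R) {f g : R} (hf : f + f = f) (hg : g + g = g) :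
    x * (f + g) = x * f + x * g := by
  apply le_antisymm
  · apply le_inf (mul_idem x (add_idem hf hg))
    · exact IsQSring.mul_mono _ _ _ (add_idem_le f hg)
    · apply IsQSring.mul_mono
      rw [IsQSring.add_comm]
      exact add_idem_le g hf
  · exact IsQSring.quasi_distrib _ _ _

/-- Leibniz's rule. -/
theorem ep_mul (x y : R) : ep (x * y) = qv x * ep y + qv y * ep x := by
  have h : eb (x * y) = eb x * eb y := by
    unfold eb
    rw [mul_inv']
    ac_rfl
  rw [ep_eq (x * y), h, ep_mul_of_idem (eb_idem x) (eb_idem y),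
    distrib_idem _ (ep_idem _) (ep_idem _), qv_mul, ep_eq x, ep_eq y, IsQSring.add_comm]
  congr 1 <;> ac_rfl

theorem inv_anti {f g : R} (hf : f + f = f) (hg : g + g = g) (h : f ⊴ g) : g⁻¹ ⊴ f⁻¹ := by
  have h' := IsQSring.mul_mono (f⁻¹ * g⁻¹) _ _ h
  have e1 : f⁻¹ * g⁻¹ * f = g⁻¹ := by
    calc f⁻¹ * g⁻¹ * f = g⁻¹ * (f * f⁻¹) := by ac_rfl
      _ = g⁻¹ := by rw [mul_inv_of_idem hf, mul_eps_of_idem (inv_idem hg)]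
  have e2 : f⁻¹ * g⁻¹ * g = f⁻¹ := by
    rw [IsQSring.mul_assoc, IsQSring.mul_comm g⁻¹, mul_inv_of_idem hg,
      mul_eps_of_idem (inv_idem hf)]
  rwa [e1, e2] at h'

end QSring

section Directed

variable {R : Type*} [QOps R] [IsDirectedQSring R]

theorem qv_le (x : R) : qv x ⊴ x := by
  have h := IsQSring.mul_mono x _ _ (IsDirectedQSring.eps_le (eb x) (eb_idem x))
  rwa [mul_eb, IsQSring.mul_comm] at h

theorem eq_of_ep_eq {x y : R} (hx : x * x = x) (hy : y * y = y) (h : ep x = ep y) : x = y := by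
  have hxy : (x * y) * (x * y) = x * y := by
    calc (x * y) * (x * y) = (x * x) * (y * y) := by ac_rfl
      _ = _ := by rw [hx, hy]
  have h1 : ep x ⊴ qv (x + -y) := by
    have h2 := IsQSring.quasi_distrib (x * y) x (-y)
    have e1 : x * y * x = x * y := by
      calc x * y * x = x * x * y := by ac_rfl
        _ = _ := by rw [hx]
    have e2 : x * y * -y = -(x * y) := by
      rw [← IsQSring.neg_mul, IsQSring.mul_assoc, hy]
    rw [e1, e2, show x * y + -(x * y) = ep (x * y) from rfl, ep_mul_of_idem hx hy, ← h,
      ep_idem] at h2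
    have h3 := qv_mono h2
    rwa [qv_of_idem (ep_idem _), qv_mul, qv_of_mul_idem hxy, eps_mul_of_idem (qv_idem _)] at h3
  have h4 : ep x ⊴ x + -y := le_trans h1 (qv_le _)
  unfold QLe at h4
  rw [ep_ep] at h4
  calc x = x + ep x := (add_ep x).symm
    _ = y + ep x := by
      conv_rhs => rw [h4]
      calc x + ep x = x + ep y + ep x := by rw [← h, IsQSring.add_assoc, ep_idem]
        _ = y + (x + -y + ep x) := by unfold ep; ac_rfl
    _ = y := by rw [h, add_ep]

theorem trunc_idem {x f : R} (hx : x * x = x) (hf : f + f = f) (hf' : eps ⊴ f)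
    (hfx : f ⊴ ep x) : (x + f) * (x + f) = x + f ∧ ep (x + f) = f := by
  have he : ep (x + f) = f := by
    rw [ep_add, ep_of_idem hf]
    exact ((le_ep_idem hf).1 hfx).symm
  have hle : x + f ⊴ x := add_idem_le x hf
  have hv : qv (x + f) = eps := by
    apply le_antisymm
    · have := qv_mono hle
      rwa [qv_of_mul_idem hx] at this
    · have := qv_mono (add_le_add (IsDirectedQSring.eps_le x hx) hf')
      rwa [eps_add, qv_of_idem eps_add] at this
  refine ⟨?_, he⟩
  have h1 : (x + f) * (x + f) ⊴ x := by
    have := mul_le_mul hle hle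
    rwa [hx] at this
  have h2 : ep ((x + f) * (x + f)) = f := by
    rw [ep_mul, hv, he, eps_mul_of_idem hf, hf]
  unfold QLe at h1
  rwa [h2] at h1

end Directed

end QS

/-! ### The `l`-valued ring associated to a superrigid directed cr-qsring -/

/-- The underlying set of the `l`-group `Λ = E⁺(R)`. -/
abbrev Idem (R : Type*) [QOps R] := {α : R // α + α = α}

/-- `Λ₊`, the set of the elements `α ≥ ε` of `Λ = E⁺(R)`. -/
abbrev PosIdem (R : Type*) [QOps R] := {α : R // α + α = α ∧ eps ⊴ α}

/-- The inverse limit `B(R)` of the groups `R_α = {x | e⁺(x) = α}`, `α ∈ Λ₊`: the maps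
`φ : Λ₊ → R` with `e⁺(φ(α)) = α`, and `φ(α) ≤ φ(β)` for `α ≤ β`. -/
@[ext] structure ResRing (R : Type*) [QOps R] where
  toFun : PosIdem R → R
  ep_apply : ∀ α, ep (toFun α) = α.1
  mono : ∀ α β : PosIdem R, α.1 ⊴ β.1 → toFun α ⊴ toFun β

namespace ResRing

open QS

section Basic

variable {R : Type*} [QOps R]

instance : CoeFun (ResRing R) (fun _ => PosIdem R → R) := ⟨ResRing.toFun⟩

variable [IsQSring R]

/-- `ε` as an element of `Λ₊`. -/
def epsPos : PosIdem R := ⟨eps, eps_add, le_refl _⟩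

/-- The product of two elements of `Λ₊`. -/
def mulPos (α β : PosIdem R) : PosIdem R :=
  ⟨α.1 * β.1, mul_idem _ β.2.1, by
    have := mul_le_mul α.2.2 β.2.2
    rwa [eps_mul] at this⟩

theorem le_mulPos_left (α β : PosIdem R) : α.1 ⊴ (mulPos α β).1 := by
  have := IsQSring.mul_mono α.1 _ _ β.2.2
  rwa [mul_eps_of_idem α.2.1] at this

theorem le_mulPos_right (α β : PosIdem R) : β.1 ⊴ (mulPos α β).1 := by
  have := IsQSring.mul_mono β.1 _ _ α.2.2
  rw [mul_eps_of_idem β.2.1, IsQSring.mul_comm] at this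
  exact this

theorem eps_le_inv_qv {x : R} (hx : ep x = eps) : eps ⊴ (qv x)⁻¹ := by
  have h := qv_le_ep x
  rw [hx] at h
  have h' := inv_anti (qv_idem x) eps_add h
  have : (eps : R)⁻¹ = eps := by
    have := mul_inv_of_idem (eps_add (R := R))
    rwa [eps_mul_of_idem (inv_idem eps_add)] at this
  rwa [this] at h'

/-- For `α ∈ Λ₊` and `φ ∈ B(R)`, the element `α • v(φ(ε))⁻¹` of `Λ₊`. -/
def shift (α : PosIdem R) (φ : ResRing R) : PosIdem R :=
  mulPos α ⟨(qv (φ epsPos))⁻¹, inv_idem (qv_idem _), eps_le_inv_qv (φ.ep_apply _)⟩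

theorem le_ep_mul (φ ψ : ResRing R) (α : PosIdem R) :
    α.1 ⊴ ep (φ (shift α ψ) * ψ (shift α φ)) := by
  have key : ∀ φ : ResRing R, ∀ γ : PosIdem R, α.1 ⊴ qv (φ γ) * (shift α φ).1 := by
    intro φ γ
    have h1 : qv (φ epsPos) ⊴ qv (φ γ) := qv_mono (φ.mono _ _ γ.2.2)
    have h2 := mul_le_mul h1 (le_refl (shift α φ).1)
    have h3 : qv (φ epsPos) * (shift α φ).1 = α.1 := by
      calc qv (φ epsPos) * (shift α φ).1
          = α.1 * (qv (φ epsPos) * (qv (φ epsPos))⁻¹) := by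
            change qv (φ epsPos) * (α.1 * (qv (φ epsPos))⁻¹) = _
            ac_rfl
        _ = α.1 := by rw [mul_inv_of_idem (qv_idem _), mul_eps_of_idem α.2.1]
    rwa [h3] at h2
  rw [ep_mul, φ.ep_apply, ψ.ep_apply]
  exact le_inf α.2.1 (key φ _) (key ψ _)

theorem eventually_mul (φ ψ : ResRing R) (α : PosIdem R) :
    ∃ γ₀ : PosIdem R, ∀ γ : PosIdem R, γ₀.1 ⊴ γ.1 →
      φ (shift α ψ) * ψ (shift α φ) + α.1 = φ γ * ψ γ + α.1 := by
  refine ⟨mulPos (shift α ψ) (shift α φ), fun γ hγ => ?_⟩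
  apply trunc α.2.1 _ (le_ep_mul φ ψ α)
  exact mul_le_mul (φ.mono _ _ (le_trans (le_mulPos_left _ _) hγ))
    (ψ.mono _ _ (le_trans (le_mulPos_right _ _) hγ))

instance : Add (ResRing R) where
  add φ ψ :=
    { toFun := fun α => φ α + ψ α
      ep_apply := fun α => by rw [ep_add, φ.ep_apply, ψ.ep_apply, α.2.1]
      mono := fun α β h => add_le_add (φ.mono α β h) (ψ.mono α β h) }

instance : Zero (ResRing R) where
  zero :=
    { toFun := fun α => α.1
      ep_apply := fun α => ep_of_idem α.2.1
      mono := fun _ _ h => h }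

instance : Neg (ResRing R) where
  neg φ :=
    { toFun := fun α => -φ α
      ep_apply := fun α => by rw [ep_neg, φ.ep_apply]
      mono := fun α β h => neg_le_neg (φ.mono α β h) }

/-- `(φ ψ)(α) = φ(α • v(ψ(ε))⁻¹) • ψ(α • v(φ(ε))⁻¹) + α` -/
instance : Mul (ResRing R) where
  mul φ ψ :=
    { toFun := fun α => φ (shift α ψ) * ψ (shift α φ) + α.1
      ep_apply := fun α => by
        rw [ep_add, ep_of_idem α.2.1]
        exact le_antisymm (le_of_add (ep_idem _) (IsQSring.add_comm _ _))
          (le_inf α.2.1 (le_ep_mul φ ψ α) (le_refl _))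
      mono := fun α β h => by
        obtain ⟨γ, hγ⟩ := eventually_mul φ ψ α
        obtain ⟨δ, hδ⟩ := eventually_mul φ ψ β
        rw [hγ (mulPos γ δ) (le_mulPos_left _ _), hδ (mulPos γ δ) (le_mulPos_right _ _)]
        exact add_le_add (le_refl _) h }

@[simp] theorem add_apply (φ ψ : ResRing R) (α : PosIdem R) : (φ + ψ) α = φ α + ψ α := rfl
@[simp] theorem zero_apply (α : PosIdem R) : (0 : ResRing R) α = α.1 := rfl
@[simp] theorem neg_apply (φ : ResRing R) (α : PosIdem R) : (-φ) α = -φ α := rfl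

/-- The product of `B(R)` as a limit: `(φ ψ)(α) = φ(γ) • ψ(γ) + α` for `γ` large. -/
theorem mul_apply (φ ψ : ResRing R) (α : PosIdem R) :
    ∃ γ₀ : PosIdem R, ∀ γ : PosIdem R, γ₀.1 ⊴ γ.1 → (φ * ψ) α = φ γ * ψ γ + α.1 :=
  eventually_mul φ ψ α

theorem eq_of_le_add {X U α : R} (hα : α + α = α) (hX : ep X = α) (h : X ⊴ U + α) :
    X = U + α := by
  apply eq_of_le_of_ep h
  rw [hX]
  apply QS.le_antisymm
  · have := ep_mono h
    rwa [hX] at this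
  · rw [ep_add, ep_of_idem hα]
    exact le_of_add (ep_idem _) (IsQSring.add_comm _ _)

theorem mul_comm' (φ ψ : ResRing R) : φ * ψ = ψ * φ := by
  ext α
  change φ (shift α ψ) * ψ (shift α φ) + α.1 = ψ (shift α φ) * φ (shift α ψ) + α.1
  rw [IsQSring.mul_comm]

theorem mul_assoc_aux (φ ψ χ : ResRing R) (α : PosIdem R) :
    ∃ γ₀ : PosIdem R, ∀ γ : PosIdem R, γ₀.1 ⊴ γ.1 →
      (φ * ψ * χ) α = φ γ * ψ γ * χ γ + α.1 := by
  obtain ⟨γ, hγ⟩ := mul_apply (φ * ψ) χ α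
  obtain ⟨δ, hδ⟩ := mul_apply φ ψ γ
  refine ⟨mulPos γ δ, fun η hη => ?_⟩
  apply eq_of_le_add α.2.1 ((φ * ψ * χ).ep_apply α)
  rw [hγ γ (QS.le_refl _), hδ η (QS.le_trans (le_mulPos_right _ _) hη)]
  apply QS.add_le_add _ (QS.le_refl _)
  exact mul_le_mul (add_idem_le _ γ.2.1) (χ.mono _ _ (QS.le_trans (le_mulPos_left _ _) hη))

theorem mul_assoc' (φ ψ χ : ResRing R) : φ * ψ * χ = φ * (ψ * χ) := by
  ext α
  obtain ⟨γ, hγ⟩ := mul_assoc_aux φ ψ χ α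
  obtain ⟨δ, hδ⟩ := mul_assoc_aux ψ χ φ α
  rw [mul_comm' φ (ψ * χ), hγ (mulPos γ δ) (le_mulPos_left _ _),
    hδ (mulPos γ δ) (le_mulPos_right _ _)]
  congr 1
  ac_rfl

theorem mul_add' (φ ψ χ : ResRing R) : φ * (ψ + χ) = φ * ψ + φ * χ := by
  ext α
  obtain ⟨γ, hγ⟩ := mul_apply φ (ψ + χ) α
  obtain ⟨δ, hδ⟩ := mul_apply φ ψ α
  obtain ⟨η, hη⟩ := mul_apply φ χ α
  symm
  apply eq_of_le_of_ep
  · let ν := mulPos γ (mulPos δ η)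
    rw [add_apply, hγ ν (le_mulPos_left _ _),
      hδ ν (QS.le_trans (le_mulPos_left _ _) (le_mulPos_right _ _)),
      hη ν (QS.le_trans (le_mulPos_right _ _) (le_mulPos_right _ _)), add_apply]
    have : φ ν * ψ ν + α.1 + (φ ν * χ ν + α.1) = φ ν * ψ ν + φ ν * χ ν + (α.1 + α.1) := by
      ac_rfl
    rw [this, α.2.1]
    exact QS.add_le_add (IsQSring.quasi_distrib _ _ _) (QS.le_refl _)
  · rw [(φ * ψ + φ * χ).ep_apply, (φ * (ψ + χ)).ep_apply]

instance : AddCommGroup (ResRing R) where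
  add_assoc φ ψ χ := by
    ext α
    exact IsQSring.add_assoc _ _ _
  zero_add φ := by
    ext α
    change α.1 + φ α = φ α
    conv_rhs => rw [← add_ep (φ α), φ.ep_apply, IsQSring.add_comm]
  add_zero φ := by
    ext α
    change φ α + α.1 = φ α
    conv_rhs => rw [← add_ep (φ α), φ.ep_apply]
  nsmul := nsmulRec
  zsmul := zsmulRec
  neg_add_cancel φ := by
    ext α
    change -φ α + φ α = α.1
    rw [IsQSring.add_comm]
    exact φ.ep_apply α
  add_comm φ ψ := by
    ext α
    exact IsQSring.add_comm _ _

end Basic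

section Ring

variable {R : Type*} [QOps R] [IsSuperrigidQSring R]

/-- The element `1_α` of `E•` with `e⁺(1_α) = α`, for `α ∈ Λ₊`. -/
noncomputable def oneAt (α : PosIdem R) : R :=
  (IsSuperrigidQSring.exists_one α.1 α.2.1 α.2.2).choose

theorem oneAt_mul (α : PosIdem R) : oneAt α * oneAt α = oneAt α :=
  (IsSuperrigidQSring.exists_one α.1 α.2.1 α.2.2).choose_spec.1

theorem ep_oneAt (α : PosIdem R) : ep (oneAt α) = α.1 :=
  (IsSuperrigidQSring.exists_one α.1 α.2.1 α.2.2).choose_spec.2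

theorem oneAt_mono (α β : PosIdem R) (h : α.1 ⊴ β.1) : oneAt α ⊴ oneAt β := by
  rw [← ep_oneAt β] at h
  obtain ⟨h1, h2⟩ := trunc_idem (oneAt_mul β) α.2.1 α.2.2 h
  have : oneAt α = oneAt β + α.1 := eq_of_ep_eq (oneAt_mul α) h1 (by rw [h2, ep_oneAt])
  rw [this]
  exact add_idem_le _ α.2.1

noncomputable instance : One (ResRing R) where
  one :=
    { toFun := oneAt
      ep_apply := ep_oneAt
      mono := oneAt_mono }

@[simp] theorem one_apply (α : PosIdem R) : (1 : ResRing R) α = oneAt α := rfl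

theorem one_mul' (φ : ResRing R) : 1 * φ = φ := by
  ext α
  obtain ⟨γ, hγ⟩ := mul_apply 1 φ α
  let δ : PosIdem R := ⟨ep (eb (φ α)), ep_idem _, by
    have h := qv_le_ep (eb (φ α))
    rwa [qv_of_mul_idem (eb_idem _)] at h⟩
  have hδ : oneAt δ = eb (φ α) := eq_of_ep_eq (oneAt_mul δ) (eb_idem _) (ep_oneAt δ)
  let ν := mulPos γ (mulPos δ α)
  have h1 : φ α ⊴ oneAt ν * φ ν := by
    have : φ α = oneAt δ * φ α := by rw [hδ, IsQSring.mul_comm, mul_eb]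
    rw [this]
    exact mul_le_mul
      (oneAt_mono _ _ (le_trans (le_mulPos_left _ _) (le_mulPos_right _ _)))
      (φ.mono _ _ (le_trans (le_mulPos_right _ _) (le_mulPos_right _ _)))
  rw [hγ ν (le_mulPos_left _ _), one_apply]
  have h2 := trunc α.2.1 h1 (by rw [φ.ep_apply]; exact le_refl _)
  rw [← h2]
  conv_rhs => rw [← add_ep (φ α), φ.ep_apply]

noncomputable instance : CommRing (ResRing R) :=
  { (inferInstance : AddCommGroup (ResRing R)), (inferInstance : Mul (ResRing R)),
    (inferInstance : One (ResRing R)) with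
    mul_assoc := mul_assoc'
    mul_comm := mul_comm'
    one_mul := one_mul'
    mul_one := fun φ => by rw [mul_comm', one_mul']
    left_distrib := mul_add'
    right_distrib := fun φ ψ χ => by
      rw [mul_comm' (φ + ψ) χ, mul_add', mul_comm' χ φ, mul_comm' χ ψ]
    zero_mul := fun φ => by
      have h := mul_add' φ 0 0
      rw [add_zero, left_eq_add] at h
      rw [mul_comm', h]
    mul_zero := fun φ => by
      have h := mul_add' φ 0 0
      rwa [add_zero, left_eq_add] at h }

end Ring

end ResRing

section Valuation

open QS ResRing

variable (R : Type*) [QOps R]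

/-- The embedding `Λ → Λ^`, `γ ↦ ι_γ`, `ι_γ(α) = γ ∧ α`, where the elements of the `l`-monoid
`Λ^` are viewed as maps `Λ₊ → Λ ⊆ R`. (On `Λ = E⁺(R)` the meet is the addition of `R`.) -/
def hatIota (γ : Idem R) : PosIdem R → R := fun α => γ.1 + α.1

variable {R}

/-- `h` is the product of `f` and `g` in the `l`-monoid `Λ^`:
`h(α) = lim_{γ → ∞} (f(γ) g(γ) ∧ α)` for all `α ∈ Λ₊`. -/
def IsHatMul (f g h : PosIdem R → R) : Prop :=
  ∀ α : PosIdem R, ∃ γ₀ : PosIdem R, ∀ γ : PosIdem R, γ₀.1 ⊴ γ.1 → h α = f γ * g γ + α.1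

/-- The `l`-valuation `w : B(R) → Λ^`, `w(φ) = v ∘ φ`. -/
def wVal (φ : ResRing R) : PosIdem R → R := fun α => qv (φ α)

variable (R) [IsSuperrigidQSring R]

/-- The `l`-valuation ring `A_w = {φ ∈ B(R) | w(φ) ≥ ε}`. -/
noncomputable def valSubring : Subring (ResRing R) where
  carrier := {φ | ∀ α, eps ⊴ wVal φ α}
  mul_mem' := by
    intro φ ψ hφ hψ α
    obtain ⟨γ, hγ⟩ := mul_apply φ ψ α
    change eps ⊴ qv ((φ * ψ) α)
    rw [hγ γ (QS.le_refl _)]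
    refine QS.le_trans ?_ (qv_add_le _ _)
    apply QS.le_inf eps_add
    · rw [qv_mul]
      have := mul_le_mul (hφ γ) (hψ γ)
      rwa [eps_mul] at this
    · rw [qv_of_idem α.2.1]
      exact α.2.2
  one_mem' := by
    intro α
    change eps ⊴ qv (oneAt α)
    rw [qv_of_mul_idem (oneAt_mul α)]
    exact QS.le_refl _
  add_mem' := by
    intro φ ψ hφ hψ α
    exact QS.le_trans (QS.le_inf eps_add (hφ α) (hψ α)) (qv_add_le _ _)
  zero_mem' := by
    intro α
    change eps ⊴ qv α.1
    rw [qv_of_idem α.2.1]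
    exact α.2.2
  neg_mem' := by
    intro φ hφ α
    change eps ⊴ qv (-φ α)
    rw [qv_neg]
    exact hφ α

variable {R}

/-- `f = ŵ(I)` for the finitely generated `A_w`-submodule `I` of `B(R)`, i.e. `f` is the meet
in `Λ^` of the `w(φ)`, where `φ` ranges over a finite list of generators of `I`. (The empty
meet is the last element `α ↦ α` of `Λ^`; it is harmless to include it in every meet.) -/
def IsWHat (I : Submodule (valSubring R) (ResRing R)) (f : PosIdem R → R) : Prop :=
  ∃ l : List (ResRing R), Submodule.span (valSubring R) {φ | φ ∈ l} = I ∧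
    ∀ α : PosIdem R, f α = (l.map (fun φ => wVal φ α)).foldr (· + ·) α.1

variable (R)

/-- `ŵ(M) ⊆ Λ^`, where `M` is the monoid of finitely generated `A_w`-submodules of `B(R)`. -/
def wHatImage : Set (PosIdem R → R) := {f | ∃ I, IsWHat I f}

/-- `ŵ(M)*`, the set of invertible elements of the submonoid `ŵ(M)` of `Λ^`. -/
def wHatUnits : Set (PosIdem R → R) :=
  {f | f ∈ wHatImage R ∧ ∃ g ∈ wHatImage R, IsHatMul f g (hatIota R ⟨eps, eps_add⟩)}

/-- A superrigid directed cr-qsring `R` is *Prüfer–Manis in a strong sense*: the ring extension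
`A_w ⊆ B(R)` is Prüfer, and `M* ≅ ŵ(M)* = Λ`, where the isomorphism is the restriction of `ŵ`
to the group `M*` of invertible `A_w`-submodules of `B(R)`. -/
structure IsPruferManisStrong : Prop where
  prufer : IsPruferExtension (valSubring R)
  units_eq : wHatUnits R = Set.range (hatIota R)
  mapsTo : ∀ I : (Submodule (valSubring R) (ResRing R))ˣ, ∃ f ∈ wHatUnits R,
    IsWHat (I : Submodule (valSubring R) (ResRing R)) f
  bijective : ∀ f ∈ wHatUnits R, ∃! I : (Submodule (valSubring R) (ResRing R))ˣ,
    IsWHat (I : Submodule (valSubring R) (ResRing R)) f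

end Valuation

/-! ### Completeness, metric, lff and median cr-qsrings -/

section Arboreal

variable (R : Type*) [QOps R]

/-- `R` is *(spherically) complete*: for every `x ∈ R` there is a map `φ : Λ → R` such that
`e⁺(φ(α)) = α`, `φ(α) ≤ φ(β)` for `α ≤ β`, and `φ(e⁺(x)) = x`. -/
def IsSphericallyComplete [IsQSring R] : Prop :=
  ∀ x : R, ∃ φ : Idem R → R, (∀ α, ep (φ α) = α.1) ∧
    (∀ α β : Idem R, α.1 ⊴ β.1 → φ α ⊴ φ β) ∧ φ ⟨ep x, QS.ep_idem x⟩ = x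

variable {R}

/-- `z` is the greatest lower bound of `S` with respect to the order `⊴`. -/
def IsMeet (S : Set R) (z : R) : Prop :=
  (∀ s ∈ S, z ⊴ s) ∧ ∀ u, (∀ s ∈ S, u ⊴ s) → u ⊴ z

/-- `z` is the least upper bound of `S` with respect to the order `⊴`. -/
def IsJoin (S : Set R) (z : R) : Prop :=
  (∀ s ∈ S, s ⊴ z) ∧ ∀ u, (∀ s ∈ S, s ⊴ u) → z ⊴ u

/-- In a directed cr-qsring any two elements have a greatest lower bound,
`x ∧ y = x + v(x - y)`. -/
theorem exists_isMeet [IsDirectedQSring R] (x y : R) : ∃ z, IsMeet {x, y} z := by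
  have h1 : qv (x + -y) ⊴ ep y := by
    refine QS.le_trans (QS.qv_le_ep _) ?_
    rw [QS.ep_add, QS.ep_neg, IsQSring.add_comm]
    exact QS.add_idem_le _ (QS.ep_idem _)
  have h2 : x + qv (x + -y) ⊴ y := by
    have h4 : x + qv (x + -y) = y + qv (x + -y) := by
      have h5 : qv (x + -y) = x + -y + qv (x + -y) := by
        have := QS.qv_le (x + -y)
        unfold QLe at this
        rwa [QS.ep_of_idem (QS.qv_idem _)] at this
      have h6 : qv (x + -y) = ep y + qv (x + -y) := (QS.le_ep_idem (QS.qv_idem _)).1 h1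
      conv_rhs => rw [h5]
      conv_lhs => rw [h6]
      unfold ep
      ac_rfl
    rw [h4]
    exact QS.add_idem_le _ (QS.qv_idem _)
  refine ⟨x + qv (x + -y), ?_, ?_⟩
  · rintro s (rfl | rfl)
    · exact QS.add_idem_le _ (QS.qv_idem _)
    · exact h2
  · intro u hu
    have hx : u ⊴ x := hu x (by simp)
    have hy : u ⊴ y := hu y (by simp)
    have h3 := QS.qv_mono (QS.add_le_add hx (QS.neg_le_neg hy))
    change qv (ep u) ⊴ _ at h3
    rw [QS.qv_of_idem (QS.ep_idem u)] at h3
    have h4 := QS.add_le_add hx h3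
    rwa [QS.add_ep] at h4

variable [IsDirectedQSring R]

/-- The meet `x ∧ y` with respect to the order of a directed cr-qsring. -/
noncomputable def meet (x y : R) : R := (exists_isMeet x y).choose

/-- The `Λ`-valued distance `d(x, y) = e⁺(x) e⁺(y) e⁺(x ∧ y)⁻²`. -/
noncomputable def qdist (x y : R) : R :=
  ep x * ep y * (ep (meet x y) * ep (meet x y))⁻¹

/-- The cell `[x, y] = {z | x ∧ y ≤ z = (x ∧ z) ∨ (y ∧ z)}`. -/
def cell (x y : R) : Set R := {z | meet x y ⊴ z ∧ IsJoin {meet x z, meet y z} z}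

/-- `m ∈ [x, y] ∩ [y, z] ∩ [z, x]`. -/
def IsMedianPoint (x y z m : R) : Prop := m ∈ cell x y ∧ m ∈ cell y z ∧ m ∈ cell z x

variable (R)

/-- `R` is *locally faithfully full* (lff): for all `x, y`, the map
`d(x, -) : [x, y] → [ε, d(x, y)]` is bijective. -/
def IsLFF : Prop :=
  ∀ x y : R, Set.BijOn (qdist x) (cell x y) {γ | γ + γ = γ ∧ eps ⊴ γ ∧ γ ⊴ qdist x y}

/-- `R` is *median*: for all `x, y, z`, the set `[x, y] ∩ [y, z] ∩ [z, x]` has exactly one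
element. -/
def IsMedianQSring : Prop := ∀ x y z : R, ∃! m, IsMedianPoint x y z m

end Arboreal

/-! ### The residue structure of a Prüfer extension -/

/-- The residue structure `R_{B/A} = ⊔_α B/α`, the disjoint union of the `A`-modules `B/α`, where
`α` ranges over the group `Λ` of invertible `A`-submodules of `B`. -/
def Residue {B : Type*} [CommRing B] (A : Subring B) : Type _ :=
  Σ α : (Submodule A B)ˣ, B ⧸ (α : Submodule A B)

namespace Residue

variable {B : Type*} [CommRing B] {A : Subring B}

/-- The element `x mod α` of `R_{B/A}`. -/
def mk (x : B) (α : (Submodule A B)ˣ) : Residue A := ⟨α, Submodule.Quotient.mk x⟩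

theorem mk_eq_mk {x y : B} {α β : (Submodule A B)ˣ} :
    mk x α = mk y β ↔ α = β ∧ x - y ∈ (α : Submodule A B) := by
  constructor
  · intro h
    obtain rfl : α = β := congrArg Sigma.fst h
    refine ⟨rfl, ?_⟩
    rw [← Submodule.Quotient.eq]
    exact eq_of_heq (Sigma.mk.inj_iff.1 h).2
  · rintro ⟨rfl, h⟩
    rw [← Submodule.Quotient.eq] at h
    exact congrArg (Sigma.mk α) h

/-- The submodule `α` of an element of `B/α`. -/
def modulus (x : Residue A) : (Submodule A B)ˣ := x.1

/-- A representative in `B` of an element of `B/α`. -/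
noncomputable def rep (x : Residue A) : B := Quotient.out x.2

theorem mk_rep (x : Residue A) : mk (rep x) (modulus x) = x := by
  obtain ⟨α, x⟩ := x
  have : Submodule.Quotient.mk (Quotient.out x) = x := Quotient.out_eq x
  exact congrArg (Sigma.mk α) this

@[simp] theorem modulus_mk (x : B) (α : (Submodule A B)ˣ) : modulus (mk x α) = α := rfl

theorem rep_mk_sub_mem (x : B) (α : (Submodule A B)ˣ) :
    rep (mk x α) - x ∈ (α : Submodule A B) :=
  (mk_eq_mk.1 (mk_rep (mk x α))).2

variable [IsPruferExtension A]

/-- `v(x mod α) = α + A x`. -/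
noncomputable def val (x : Residue A) : (Submodule A B)ˣ := addGen (modulus x) (rep x)

theorem addGen_congr {x y : B} {α : (Submodule A B)ˣ} (h : x - y ∈ (α : Submodule A B)) :
    addGen α x = addGen α y := by
  have key : ∀ x y : B, x - y ∈ (α : Submodule A B) →
      (addGen α x : Submodule A B) ≤ (addGen α y : Submodule A B) := by
    intro x y h
    rw [coe_addGen, coe_addGen]
    refine sup_le le_sup_left ?_
    rw [Submodule.span_singleton_le_iff_mem]
    have : x = (x - y) + y := by ring
    rw [this]
    exact Submodule.add_mem_sup h (Submodule.mem_span_singleton_self y)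
  apply Units.ext
  apply le_antisymm (key x y h)
  apply key y x
  rw [← neg_sub]
  exact Submodule.neg_mem _ h

theorem val_mk (x : B) (α : (Submodule A B)ˣ) : val (mk x α) = addGen α x :=
  addGen_congr (rep_mk_sub_mem x α)

/-- An element `z ∈ v⁻¹` with `x z ≡ 1 mod v⁻¹ α`, where `v = α + A x`. -/
theorem exists_inv (x : B) (α : (Submodule A B)ˣ) :
    ∃ z ∈ (((addGen α x)⁻¹ : (Submodule A B)ˣ) : Submodule A B),
      x * z - 1 ∈ (((addGen α x)⁻¹ * α : (Submodule A B)ˣ) : Submodule A B) := by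
  have h : (1 : B) ∈ (((addGen α x)⁻¹ * addGen α x : (Submodule A B)ˣ) : Submodule A B) := by
    rw [inv_mul_cancel]
    exact Submodule.one_le.1 le_rfl
  rw [Units.val_mul, coe_addGen, Submodule.mul_sup, Submodule.mem_sup] at h
  obtain ⟨a, ha, b, hb, hab⟩ := h
  obtain ⟨z, hz, rfl⟩ := Submodule.mem_mul_span_singleton.1 hb
  refine ⟨z, hz, ?_⟩
  have : x * z - 1 = -a := by rw [← hab]; ring
  rw [this]
  exact Submodule.neg_mem _ ha

/-- The operations of the residue structure: for `𝐱 = x mod α` and `𝐲 = y mod β`,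
`𝐱 + 𝐲 = (x + y) mod (α + β)`, `𝐱 • 𝐲 = x y mod (α v(𝐲) + β v(𝐱))`, `-𝐱 = (-x) mod α`,
`𝐱⁻¹ = z mod α v(𝐱)⁻²`, where `z ∈ v(𝐱)⁻¹` and `x z ≡ 1 mod v(𝐱)⁻¹ α`, and `ε = 0 mod A`.
They do not depend on the choices made, see the lemmas below. -/
noncomputable instance : QOps (Residue A) where
  add x y := mk (rep x + rep y) (addInv (modulus x) (modulus y))
  mul x y := mk (rep x * rep y) (addInv (modulus x * val y) (modulus y * val x))
  neg x := mk (-rep x) (modulus x)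
  inv x := mk (exists_inv (rep x) (modulus x)).choose (modulus x * (val x ^ 2)⁻¹)
  eps := mk 0 1

theorem mk_add_mk (x y : B) (α β : (Submodule A B)ˣ) :
    mk x α + mk y β = mk (x + y) (addInv α β) := by
  refine mk_eq_mk.2 ⟨rfl, ?_⟩
  rw [add_sub_add_comm]
  exact Submodule.add_mem_sup (rep_mk_sub_mem x α) (rep_mk_sub_mem y β)

theorem neg_mk (x : B) (α : (Submodule A B)ˣ) : -mk x α = mk (-x) α := by
  refine mk_eq_mk.2 ⟨rfl, ?_⟩
  rw [neg_sub_neg, ← neg_sub]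
  exact Submodule.neg_mem _ (rep_mk_sub_mem x α)

theorem mk_mul_mk (x y : B) (α β : (Submodule A B)ˣ) :
    mk x α * mk y β = mk (x * y) (addInv (α * addGen β y) (β * addGen α x)) := by
  refine mk_eq_mk.2 ⟨by rw [val_mk, val_mk, modulus_mk, modulus_mk], ?_⟩
  rw [val_mk, val_mk, modulus_mk, modulus_mk]
  have h : rep (mk x α) * rep (mk y β) - x * y =
      (rep (mk x α) - x) * rep (mk y β) + (rep (mk y β) - y) * x := by ring
  rw [h, coe_addInv]
  apply Submodule.add_mem_sup
  · apply Submodule.mul_mem_mul (rep_mk_sub_mem x α)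
    rw [← addGen_congr (rep_mk_sub_mem y β)]
    exact Submodule.mem_sup_right (Submodule.mem_span_singleton_self _)
  · apply Submodule.mul_mem_mul (rep_mk_sub_mem y β)
    exact Submodule.mem_sup_right (Submodule.mem_span_singleton_self _)

theorem inv_mk (x z : B) (α : (Submodule A B)ˣ)
    (hz : z ∈ (((addGen α x)⁻¹ : (Submodule A B)ˣ) : Submodule A B))
    (hxz : x * z - 1 ∈ (((addGen α x)⁻¹ * α : (Submodule A B)ˣ) : Submodule A B)) :
    (mk x α)⁻¹ = mk z (α * (addGen α x ^ 2)⁻¹) := by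
  refine mk_eq_mk.2 ⟨by rw [val_mk, modulus_mk], ?_⟩
  have hv : addGen α (rep (mk x α)) = addGen α x := addGen_congr (rep_mk_sub_mem x α)
  obtain ⟨h1, h2⟩ := (exists_inv (rep (mk x α)) α).choose_spec
  have hm : modulus (mk x α) * (val (mk x α) ^ 2)⁻¹ = α * (addGen α x ^ 2)⁻¹ := by
    rw [modulus_mk, val_mk]
  rw [hm]
  set z' := (exists_inv (rep (mk x α)) α).choose
  change z' - z ∈ _
  rw [hv] at h1 h2
  have hd : z' - z ∈ (((addGen α x)⁻¹ : (Submodule A B)ˣ) : Submodule A B) :=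
    Submodule.sub_mem _ h1 hz
  have hsub : Submodule.span A {z' - z} * (addGen α x : Submodule A B) ≤
      (((addGen α x)⁻¹ * α : (Submodule A B)ˣ) : Submodule A B) := by
    rw [coe_addGen, Submodule.mul_sup]
    apply sup_le
    · rw [Units.val_mul]
      exact mul_le_mul' ((Submodule.span_singleton_le_iff_mem _ _).2 hd) le_rfl
    · rw [Submodule.span_mul_span, Set.singleton_mul_singleton,
        Submodule.span_singleton_le_iff_mem]
      have h : (z' - z) * x = (rep (mk x α) * z' - 1) - z' * (rep (mk x α) - x) - (x * z - 1) := by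
        ring
      rw [h]
      refine Submodule.sub_mem _ (Submodule.sub_mem _ h2 ?_) hxz
      rw [Units.val_mul]
      exact Submodule.mul_mem_mul h1 (rep_mk_sub_mem x α)
  have h3 := mul_le_mul' hsub
    (le_refl (((addGen α x)⁻¹ : (Submodule A B)ˣ) : Submodule A B))
  rw [mul_assoc, Units.mul_inv, mul_one, ← Units.val_mul,
    Submodule.span_singleton_le_iff_mem] at h3
  have he : α * (addGen α x ^ 2)⁻¹ = (addGen α x)⁻¹ * α * (addGen α x)⁻¹ := by
    rw [pow_two, mul_inv, mul_comm (addGen α x)⁻¹ α, mul_assoc]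
  rw [he]
  exact h3

/-- The invertible submodule `α + β + A (x - y)`; it is the modulus of the meet of `x mod α` and
`y mod β`. -/
noncomputable def pairModulus (x y : B) (α β : (Submodule A B)ˣ) : (Submodule A B)ˣ :=
  addGen (addInv α β) (x - y)

/-- `x ≡ x_i ≡ x_j mod (α_i + α_j + A (x_i - x_j))` for `1 ≤ i < j ≤ 3`. -/
def MedianCongr (x₁ x₂ x₃ : B) (α₁ α₂ α₃ : (Submodule A B)ˣ) (x : B) : Prop :=
  (x - x₁ ∈ (pairModulus x₁ x₂ α₁ α₂ : Submodule A B) ∧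
    x - x₂ ∈ (pairModulus x₁ x₂ α₁ α₂ : Submodule A B)) ∧
  (x - x₁ ∈ (pairModulus x₁ x₃ α₁ α₃ : Submodule A B) ∧
    x - x₃ ∈ (pairModulus x₁ x₃ α₁ α₃ : Submodule A B)) ∧
  (x - x₂ ∈ (pairModulus x₂ x₃ α₂ α₃ : Submodule A B) ∧
    x - x₃ ∈ (pairModulus x₂ x₃ α₂ α₃ : Submodule A B))

end Residue

/-!
The order of `Λ` is the opposite of the inclusion of submodules; below, the invertible submodules
are ordered by inclusion. Because `A ⊆ B` is Prüfer, they form a lattice with supremum `α + β`, and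
inverting turns suprema into infima, so `α ∩ β = (α⁻¹ + β⁻¹)⁻¹` is invertible. Hence they form a
commutative `l`-group, and in particular a distributive lattice. Everything about the cells of the
residue structure is reduced to this `l`-group, without localizing at maximal ideals.

The axioms of a cr-qsring follow from the Leibniz rule `v(𝐱 • 𝐲) = v(𝐱) v(𝐲)`
(`addGen_mul_addGen`) and from `v(𝐱⁻¹) = v(𝐱)⁻¹` (`addGen_inv_mk`). Completeness is witnessed by
`β ↦ x mod β`.

A point `z` of a cell `[x, y]` with `μ = e⁺(x ∧ y)` is determined by `p = e⁺(x ∧ z)` and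
`q = e⁺(y ∧ z)`, which satisfy `p + q = μ` and `p ∩ q = e⁺(z)`; conversely, given such `p` and `q`,
the element `z` is found by solving `z ≡ x mod p`, `z ≡ y mod q`. The distance `d(x, z)` is, up to
the fixed factor `e⁺(x) μ⁻¹`, the quotient `q p⁻¹`, and in an `l`-group the pair `(p, q)` with
`p + q = μ` is recovered from that quotient as `p = μ (1 + q p⁻¹)⁻¹`. This gives `isLFF`.
For the median, the pairwise moduli satisfy the ultrametric inequality, so that distributivity
yields the Chinese remainder theorem `exists_medianCongr`; uniqueness is the self-duality of
medians in a distributive lattice (`eq_of_isMedianPoint`).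

The ring `B(R)` is the completion of `B`. An element of it differs from an element of `B` by an
element of the completion `A_w` of `A`, so the Prüfer condition for `A ⊆ B` passes to
`A_w ⊆ B(R)`. The value of `ŵ(I)` at `γ` is the module `trace I γ` of all representatives modulo
`γ` of elements of `I` (`isWHat_iff`), and `trace` is multiplicative in the limit (`trace_mul`).
If `ŵ(I)` is invertible, its values are eventually constant, because two decreasing nets of
invertible modules with product `A` are constant (`exists_eq_hatIota`); so `ŵ(I)` comes from some
`δ ∈ Λ`, and it is also the value of `ŵ` at the extension `δ A_w`. An invertible `I` with
`ŵ(I) = ŵ(J)` satisfies `ŵ(I J⁻¹) = ε`, i.e. `I J⁻¹ ⊆ A_w`, whence `I = J` (`le_of_isWHat`).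
-/

namespace Residue

variable {B : Type*} [CommRing B] {A : Subring B}

/-! ### The `l`-group of invertible submodules -/

section InvertibleSubmodules

instance : IsOrderedMonoid (Submodule A B)ˣ where
  mul_le_mul_left _ _ h _ := mul_le_mul' (α := Submodule A B) h le_rfl

theorem mul_mem_mul {α β : (Submodule A B)ˣ} {x y : B} (hx : x ∈ (α : Submodule A B))
    (hy : y ∈ (β : Submodule A B)) : x * y ∈ ((α * β : (Submodule A B)ˣ) : Submodule A B) :=
  Submodule.mul_mem_mul hx hy

theorem one_mem_coe_one : (1 : B) ∈ ((1 : (Submodule A B)ˣ) : Submodule A B) :=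
  Submodule.one_le.1 le_rfl

theorem mem_coe_one {x : B} : x ∈ ((1 : (Submodule A B)ˣ) : Submodule A B) ↔ x ∈ A :=
  mem_one_iff_mem

variable [IsPruferExtension A]

/-- The invertible submodules of a Prüfer extension form a lattice under inclusion: the supremum
is `α + β`, and the infimum is `(α⁻¹ + β⁻¹)⁻¹ = α ∩ β`. This order is opposite to that of the
`l`-group `Λ`. -/
noncomputable instance : Lattice (Submodule A B)ˣ where
  sup := addInv
  le_sup_left _ _ := le_sup_left (α := Submodule A B)
  le_sup_right _ _ := le_sup_right (α := Submodule A B)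
  sup_le _ _ _ h₁ h₂ := sup_le (α := Submodule A B) h₁ h₂
  inf α β := (addInv α⁻¹ β⁻¹)⁻¹
  inf_le_left α β := inv_le_of_inv_le' (le_sup_left (α := Submodule A B))
  inf_le_right α β := inv_le_of_inv_le' (le_sup_right (α := Submodule A B))
  le_inf α β γ h₁ h₂ := by
    refine le_inv_of_le_inv (sup_le (α := Submodule A B) ?_ ?_)
    · exact inv_le_inv' h₁
    · exact inv_le_inv' h₂

noncomputable instance : DistribLattice (Submodule A B)ˣ := CommGroup.toDistribLattice _

theorem addInv_eq_sup (α β : (Submodule A B)ˣ) : addInv α β = α ⊔ β := rfl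

@[simp] theorem coe_sup (α β : (Submodule A B)ˣ) :
    ((α ⊔ β : (Submodule A B)ˣ) : Submodule A B) = (α : Submodule A B) ⊔ β := rfl

@[simp] theorem coe_inf (α β : (Submodule A B)ˣ) :
    ((α ⊓ β : (Submodule A B)ˣ) : Submodule A B) = (α : Submodule A B) ⊓ β := by
  apply le_antisymm
  · exact le_inf (inf_le_left (a := α) (b := β)) (inf_le_right (a := α) (b := β))
  · -- A submodule `N ⊆ α ∩ β` satisfies `N α⁻¹ ⊆ A` and `N β⁻¹ ⊆ A`.
    have h : ∀ γ : (Submodule A B)ˣ, (α : Submodule A B) ⊓ β ≤ γ →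
        ((α : Submodule A B) ⊓ β) * ((γ⁻¹ : (Submodule A B)ˣ) : Submodule A B) ≤ 1 := by
      intro γ h
      rw [← Units.mul_inv γ]
      exact mul_le_mul' h le_rfl
    have h₁ : ((α : Submodule A B) ⊓ β) * (addInv α⁻¹ β⁻¹ : (Submodule A B)ˣ) ≤ 1 := by
      rw [coe_addInv, Submodule.mul_sup]
      exact sup_le (h α _root_.inf_le_left) (h β _root_.inf_le_right)
    have h₂ := mul_le_mul' h₁
      (le_refl (((addInv α⁻¹ β⁻¹)⁻¹ : (Submodule A B)ˣ) : Submodule A B))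
    rwa [mul_assoc, Units.mul_inv, mul_one, one_mul] at h₂

theorem mem_inf {α β : (Submodule A B)ˣ} {x : B} :
    x ∈ ((α ⊓ β : (Submodule A B)ˣ) : Submodule A B) ↔
      x ∈ (α : Submodule A B) ∧ x ∈ (β : Submodule A B) := by
  rw [coe_inf, Submodule.mem_inf]

theorem mem_sup_left {α β : (Submodule A B)ˣ} {x : B} (h : x ∈ (α : Submodule A B)) :
    x ∈ ((α ⊔ β : (Submodule A B)ˣ) : Submodule A B) := (le_sup_left : α ≤ α ⊔ β) h

theorem mem_sup_right {α β : (Submodule A B)ˣ} {x : B} (h : x ∈ (β : Submodule A B)) :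
    x ∈ ((α ⊔ β : (Submodule A B)ˣ) : Submodule A B) := (le_sup_right : β ≤ α ⊔ β) h

theorem addGen_le {α γ : (Submodule A B)ˣ} {x : B} :
    addGen α x ≤ γ ↔ α ≤ γ ∧ x ∈ (γ : Submodule A B) := by
  rw [← Units.val_le_val, coe_addGen, sup_le_iff, Submodule.span_singleton_le_iff_mem,
    Units.val_le_val]

theorem le_addGen (α : (Submodule A B)ˣ) (x : B) : α ≤ addGen α x := (addGen_le.1 le_rfl).1

theorem mem_addGen (α : (Submodule A B)ˣ) (x : B) : x ∈ (addGen α x : Submodule A B) :=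
  (addGen_le.1 le_rfl).2

theorem addGen_of_mem {α : (Submodule A B)ˣ} {x : B} (h : x ∈ (α : Submodule A B)) :
    addGen α x = α := le_antisymm (addGen_le.2 ⟨le_rfl, h⟩) (le_addGen α x)

@[simp] theorem addGen_zero (α : (Submodule A B)ˣ) : addGen α 0 = α :=
  addGen_of_mem (Submodule.zero_mem _)

theorem addGen_mul_le {α β γ : (Submodule A B)ˣ} {x : B} :
    addGen α x * β ≤ γ ↔ α * β ≤ γ ∧ ∀ y ∈ (β : Submodule A B), x * y ∈ (γ : Submodule A B) := by
  rw [← le_mul_inv_iff_mul_le, addGen_le, le_mul_inv_iff_mul_le, and_congr_right_iff]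
  rintro -
  constructor
  · intro h y hy
    have := mul_mem_mul h hy
    rwa [inv_mul_cancel_right] at this
  · intro h
    rw [← Submodule.span_singleton_le_iff_mem]
    have h₁ : Submodule.span A {x} * (β : Submodule A B) ≤ γ := by
      rw [Submodule.mul_le]
      intro m hm n hn
      obtain ⟨a, rfl⟩ := Submodule.mem_span_singleton.1 hm
      rw [smul_mul_assoc]
      exact Submodule.smul_mem _ _ (h n hn)
    have h₂ := mul_le_mul' h₁ (le_refl ((β⁻¹ : (Submodule A B)ˣ) : Submodule A B))
    rwa [mul_assoc, Units.mul_inv, mul_one, ← Units.val_mul] at h₂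

/-- The Leibniz rule for the valuation of a product: `(α + A x) (β + A y)` is generated by
`α (β + A y)`, `β (α + A x)` and `x y`. -/
theorem addGen_mul_addGen (α β : (Submodule A B)ˣ) (x y : B) :
    addGen (α * addGen β y ⊔ β * addGen α x) (x * y) = addGen α x * addGen β y := by
  apply le_antisymm
  · refine addGen_le.2 ⟨sup_le ?_ ?_, mul_mem_mul (mem_addGen _ _) (mem_addGen _ _)⟩
    · exact mul_le_mul_left (le_addGen α x) _
    · rw [mul_comm (addGen α x)]
      exact mul_le_mul_left (le_addGen β y) _
  · rw [addGen_mul_le]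
    refine ⟨le_sup_left.trans (le_addGen _ _), fun t ht => ?_⟩
    rw [coe_addGen, Submodule.mem_sup] at ht
    obtain ⟨b, hb, c, hc, rfl⟩ := ht
    obtain ⟨a, rfl⟩ := Submodule.mem_span_singleton.1 hc
    rw [mul_add]
    refine Submodule.add_mem _ (le_addGen _ _ (mem_sup_right ?_)) ?_
    · rw [mul_comm x b]
      exact mul_mem_mul hb (mem_addGen _ _)
    · rw [mul_smul_comm]
      exact Submodule.smul_mem _ _ (mem_addGen _ _)

end InvertibleSubmodules

/-! ### The residue structure is a superrigid directed cr-qsring -/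

theorem exists_mk (z : Residue A) : ∃ x α, z = mk x α := ⟨_, _, (mk_rep z).symm⟩

theorem mk_eq_mk_zero {x : B} {α : (Submodule A B)ˣ} (h : x ∈ (α : Submodule A B)) :
    mk x α = mk 0 α := mk_eq_mk.2 ⟨rfl, by rwa [sub_zero]⟩

theorem mk_zero_inj {α β : (Submodule A B)ˣ} : mk 0 α = mk 0 β ↔ α = β := by
  rw [mk_eq_mk, sub_self]
  exact and_iff_left (Submodule.zero_mem _)

variable [IsPruferExtension A]

theorem add_mk (x y : B) (α β : (Submodule A B)ˣ) :
    mk x α + mk y β = mk (x + y) (α ⊔ β) := mk_add_mk x y α β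

theorem mul_mk (x y : B) (α β : (Submodule A B)ˣ) :
    mk x α * mk y β = mk (x * y) (α * addGen β y ⊔ β * addGen α x) := mk_mul_mk x y α β

theorem eps_eq : (eps : Residue A) = mk 0 1 := rfl

theorem ep_mk (x : B) (α : (Submodule A B)ˣ) : ep (mk x α) = mk 0 α := by
  rw [ep, neg_mk, add_mk, sup_idem, add_neg_cancel]

theorem mk_le_mk {x y : B} {α β : (Submodule A B)ˣ} :
    mk x α ⊴ mk y β ↔ β ≤ α ∧ x - y ∈ (α : Submodule A B) := by
  rw [QLe, ep_mk, add_mk, add_zero, mk_eq_mk, right_eq_sup]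

theorem mk_add_self {x : B} {α : (Submodule A B)ˣ} :
    mk x α + mk x α = mk x α ↔ x ∈ (α : Submodule A B) := by
  rw [add_mk, mk_eq_mk, sup_idem, add_sub_cancel_right]
  exact ⟨fun h => h.2, fun h => ⟨rfl, h⟩⟩

theorem mk_mul_self {x : B} {α : (Submodule A B)ˣ} :
    mk x α * mk x α = mk x α ↔ addGen α x = 1 ∧ x * x - x ∈ (α : Submodule A B) := by
  rw [mul_mk, mk_eq_mk, sup_idem, mul_eq_left]
  refine and_congr_right fun h => ?_
  rw [h, mul_one]

theorem add_idem_iff {z : Residue A} : z + z = z ↔ ∃ γ, z = mk 0 γ := by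
  obtain ⟨x, α, rfl⟩ := exists_mk z
  rw [mk_add_self]
  refine ⟨fun h => ⟨α, mk_eq_mk_zero h⟩, ?_⟩
  rintro ⟨γ, h⟩
  simpa using (mk_eq_mk.1 h).2

theorem addGen_inv_mk {x z : B} {α : (Submodule A B)ˣ}
    (hz : z ∈ (((addGen α x)⁻¹ : (Submodule A B)ˣ) : Submodule A B))
    (hxz : x * z - 1 ∈ (((addGen α x)⁻¹ * α : (Submodule A B)ˣ) : Submodule A B)) :
    addGen (α * (addGen α x ^ 2)⁻¹) z = (addGen α x)⁻¹ := by
  set v := addGen α x with hv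
  have e : α * (v ^ 2)⁻¹ * v = v⁻¹ * α := by
    rw [pow_two, mul_inv, mul_assoc, mul_assoc, inv_mul_cancel, mul_one, mul_comm]
  apply le_antisymm
  · refine addGen_le.2 ⟨?_, hz⟩
    rw [← mul_le_mul_iff_right v, e, inv_mul_cancel, inv_mul_le_one_iff]
    exact le_addGen α x
  · rw [← mul_le_mul_iff_right v, inv_mul_cancel]
    have h1 : x * z ∈ ((addGen (α * (v ^ 2)⁻¹) z * v : (Submodule A B)ˣ) : Submodule A B) := by
      rw [mul_comm x z]
      exact mul_mem_mul (mem_addGen _ _) (mem_addGen _ _)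
    have h2 : x * z - 1 ∈ ((addGen (α * (v ^ 2)⁻¹) z * v : (Submodule A B)ˣ) : Submodule A B) := by
      rw [← e] at hxz
      exact mul_le_mul_left (le_addGen (α * (v ^ 2)⁻¹) z) v hxz
    have h3 := Submodule.sub_mem _ h1 h2
    rw [sub_sub_cancel] at h3
    exact Submodule.one_le.2 h3

theorem le_one_and_mem_one_of_mul_self {x : B} {α : (Submodule A B)ˣ} (h : mk x α * mk x α = mk x α) :
    α ≤ 1 ∧ x ∈ ((1 : (Submodule A B)ˣ) : Submodule A B) := by
  obtain ⟨h, -⟩ := mk_mul_self.1 h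
  exact addGen_le.1 h.le

instance : IsSuperrigidQSring (Residue A) where
  add_comm x y := by
    obtain ⟨x, α, rfl⟩ := exists_mk x
    obtain ⟨y, β, rfl⟩ := exists_mk y
    rw [add_mk, add_mk, add_comm x, sup_comm]
  add_assoc x y z := by
    obtain ⟨x, α, rfl⟩ := exists_mk x
    obtain ⟨y, β, rfl⟩ := exists_mk y
    obtain ⟨z, γ, rfl⟩ := exists_mk z
    rw [add_mk, add_mk, add_mk, add_mk, add_assoc, sup_assoc]
  add_add_neg x := by
    obtain ⟨x, α, rfl⟩ := exists_mk x
    rw [neg_mk, add_mk, add_mk, sup_idem, sup_idem, add_neg_cancel_right]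
  neg_neg_add x := by
    obtain ⟨x, α, rfl⟩ := exists_mk x
    rw [neg_mk, add_mk, add_mk, sup_idem, sup_idem, neg_add_cancel_right]
  mul_comm x y := by
    obtain ⟨x, α, rfl⟩ := exists_mk x
    obtain ⟨y, β, rfl⟩ := exists_mk y
    rw [mul_mk, mul_mk, mul_comm x, sup_comm]
  mul_assoc x y z := by
    obtain ⟨x, α, rfl⟩ := exists_mk x
    obtain ⟨y, β, rfl⟩ := exists_mk y
    obtain ⟨z, γ, rfl⟩ := exists_mk z
    rw [mul_mk, mul_mk, mul_mk, mul_mk, addGen_mul_addGen, addGen_mul_addGen, mul_assoc x]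
    congr 1
    simp only [sup_mul, mul_assoc, sup_assoc]
    congr 2
    · rw [mul_comm (addGen α x)]
    · rw [mul_comm (addGen α x)]
  mul_mul_inv x := by
    obtain ⟨x, α, rfl⟩ := exists_mk x
    obtain ⟨z, hz, hxz⟩ := exists_inv x α
    rw [inv_mk x z α hz hxz, mul_mk, mul_mk, addGen_mul_addGen, addGen_inv_mk hz hxz, sup_idem,
      mk_eq_mk]
    have e : α * addGen α x * (addGen α x)⁻¹ ⊔
        α * (addGen α x ^ 2)⁻¹ * (addGen α x * addGen α x) = α := by
      rw [pow_two, inv_mul_cancel_right, mul_inv_cancel_right, sup_idem]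
    refine ⟨e, ?_⟩
    rw [e]
    have h := mul_mem_mul (mem_addGen α x) hxz
    rw [mul_inv_cancel_left] at h
    have e' : x * x * z - x = x * (x * z - 1) := by ring
    rwa [e']
  inv_inv_mul x := by
    obtain ⟨x, α, rfl⟩ := exists_mk x
    obtain ⟨z, hz, hxz⟩ := exists_inv x α
    rw [inv_mk x z α hz hxz, mul_mk, mul_mk, addGen_mul_addGen, addGen_inv_mk hz hxz, sup_idem,
      mk_eq_mk]
    have e : α * (addGen α x ^ 2)⁻¹ * (addGen α x)⁻¹ * addGen α x ⊔
        α * ((addGen α x)⁻¹ * (addGen α x)⁻¹) = α * (addGen α x ^ 2)⁻¹ := by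
      rw [pow_two, inv_mul_cancel_right, mul_inv, sup_idem]
    refine ⟨e, ?_⟩
    rw [e]
    have h := mul_mem_mul hz hxz
    have e' : z * z * x - z = z * (x * z - 1) := by ring
    have e'' : α * (addGen α x ^ 2)⁻¹ = (addGen α x)⁻¹ * ((addGen α x)⁻¹ * α) := by
      rw [pow_two, mul_inv, mul_comm α, mul_assoc]
    rwa [e', e'']
  idem_iff x := by
    obtain ⟨x, α, rfl⟩ := exists_mk x
    rw [mk_add_self, mk_mul_self, eps_eq, mk_eq_mk, sub_zero]
    constructor
    · rintro ⟨h, h', -⟩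
      rw [addGen_of_mem h] at h'
      exact ⟨h', h⟩
    · rintro ⟨rfl, h⟩
      refine ⟨h, addGen_of_mem h, Submodule.sub_mem _ ?_ h⟩
      have := mul_mem_mul h h
      rwa [mul_one] at this
  quasi_distrib x y z := by
    obtain ⟨x, α, rfl⟩ := exists_mk x
    obtain ⟨y, β, rfl⟩ := exists_mk y
    obtain ⟨z, γ, rfl⟩ := exists_mk z
    rw [mul_mk, mul_mk, add_mk, add_mk, mul_mk, mk_le_mk]
    refine ⟨?_, by rw [mul_add, sub_self]; exact Submodule.zero_mem _⟩
    have h : addGen (β ⊔ γ) (y + z) ≤ addGen β y ⊔ addGen γ z := by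
      refine addGen_le.2 ⟨sup_le_sup (le_addGen _ _) (le_addGen _ _), ?_⟩
      exact Submodule.add_mem_sup (mem_addGen _ _) (mem_addGen _ _)
    refine (sup_le_sup_right (mul_le_mul_right h α) _).trans ?_
    rw [mul_sup, sup_mul, sup_sup_sup_comm]
  mul_mono x y z h := by
    obtain ⟨x, α, rfl⟩ := exists_mk x
    obtain ⟨y, β, rfl⟩ := exists_mk y
    obtain ⟨z, γ, rfl⟩ := exists_mk z
    obtain ⟨h1, h2⟩ := mk_le_mk.1 h
    rw [mul_mk, mul_mk, mk_le_mk]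
    refine ⟨sup_le_sup (mul_le_mul_right ?_ α) (mul_le_mul_left h1 _), ?_⟩
    · rw [addGen_congr h2]
      exact addGen_le.2 ⟨h1.trans (le_addGen _ _), mem_addGen _ _⟩
    · rw [← mul_sub, mul_comm x]
      exact mem_sup_right (mul_mem_mul h2 (mem_addGen _ _))
  neg_mul x y := by
    obtain ⟨x, α, rfl⟩ := exists_mk x
    obtain ⟨y, β, rfl⟩ := exists_mk y
    have h : addGen β (-y) = addGen β y := by
      apply le_antisymm
      · exact addGen_le.2 ⟨le_addGen _ _, Submodule.neg_mem _ (mem_addGen _ _)⟩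
      · refine addGen_le.2 ⟨le_addGen _ _, ?_⟩
        have := Submodule.neg_mem _ (mem_addGen β (-y))
        rwa [neg_neg] at this
    rw [neg_mk, mul_mk, mul_mk, neg_mk, h, mul_neg]
  ep_add_le x y hx hy := by
    obtain ⟨x, α, rfl⟩ := exists_mk x
    obtain ⟨y, β, rfl⟩ := exists_mk y
    rw [add_mk, mul_mk, ep_mk, ep_mk, (mk_mul_self.1 hx).1, (mk_mul_self.1 hy).1, mul_one,
      mul_one]
    exact mk_le_mk.2 ⟨le_rfl, by rw [sub_self]; exact Submodule.zero_mem _⟩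
  eps_le x hx := by
    obtain ⟨x, α, rfl⟩ := exists_mk x
    obtain ⟨h1, h2⟩ := le_one_and_mem_one_of_mul_self hx
    rw [eps_eq, mk_le_mk, zero_sub]
    exact ⟨h1, Submodule.neg_mem _ h2⟩
  exists_one z hz hz' := by
    obtain ⟨α, rfl⟩ := add_idem_iff.1 hz
    rw [eps_eq, mk_le_mk] at hz'
    refine ⟨mk 1 α, ?_, ep_mk _ _⟩
    rw [mk_mul_self, mul_one, sub_self]
    refine ⟨le_antisymm (addGen_le.2 ⟨hz'.1, one_mem_coe_one⟩) ?_, Submodule.zero_mem _⟩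
    exact Submodule.one_le.2 (mem_addGen α 1)

theorem isSphericallyComplete : IsSphericallyComplete (Residue A) := by
  intro z
  obtain ⟨x, α, rfl⟩ := exists_mk z
  have h : ∀ β : Idem (Residue A), β.1 = mk 0 (modulus β.1) := by
    rintro ⟨β, hβ⟩
    obtain ⟨γ, rfl⟩ := add_idem_iff.1 hβ
    rfl
  refine ⟨fun β => mk x (modulus β.1), fun β => ?_, fun β γ hβγ => ?_, ?_⟩
  · rw [ep_mk, ← h]
  · rw [h β, h γ, mk_le_mk] at hβγ
    rw [mk_le_mk, sub_self]
    exact ⟨hβγ.1, Submodule.zero_mem _⟩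
  · simp only [ep_mk, modulus_mk]

/-! ### Meets, joins and cells -/

theorem pairModulus_le {x y : B} {α β γ : (Submodule A B)ˣ} :
    pairModulus x y α β ≤ γ ↔ α ≤ γ ∧ β ≤ γ ∧ x - y ∈ (γ : Submodule A B) := by
  rw [pairModulus, addGen_le, addInv_eq_sup, sup_le_iff, and_assoc]

theorem le_pairModulus_left (x y : B) (α β : (Submodule A B)ˣ) : α ≤ pairModulus x y α β :=
  (pairModulus_le.1 le_rfl).1

theorem le_pairModulus_right (x y : B) (α β : (Submodule A B)ˣ) : β ≤ pairModulus x y α β :=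
  (pairModulus_le.1 le_rfl).2.1

theorem sub_mem_pairModulus (x y : B) (α β : (Submodule A B)ˣ) :
    x - y ∈ (pairModulus x y α β : Submodule A B) :=
  (pairModulus_le.1 le_rfl).2.2

theorem pairModulus_comm (x y : B) (α β : (Submodule A B)ˣ) :
    pairModulus x y α β = pairModulus y x β α := by
  have key : ∀ (x y : B) (α β : (Submodule A B)ˣ), pairModulus x y α β ≤ pairModulus y x β α := by
    intro x y α β
    refine pairModulus_le.2 ⟨le_pairModulus_right _ _ _ _, le_pairModulus_left _ _ _ _, ?_⟩
    rw [← neg_sub]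
    exact Submodule.neg_mem _ (sub_mem_pairModulus _ _ _ _)
  exact le_antisymm (key _ _ _ _) (key _ _ _ _)

theorem meet_mk (x y : B) (α β : (Submodule A B)ˣ) :
    meet (mk x α) (mk y β) = mk x (pairModulus x y α β) := by
  have h : IsMeet {mk x α, mk y β} (meet (mk x α) (mk y β)) := (exists_isMeet _ _).choose_spec
  apply QS.le_antisymm
  · obtain ⟨z, γ, hz⟩ := exists_mk (meet (mk x α) (mk y β))
    rw [hz] at h ⊢
    obtain ⟨h1, h2⟩ := mk_le_mk.1 (h.1 _ (Set.mem_insert _ _))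
    obtain ⟨h3, h4⟩ := mk_le_mk.1 (h.1 _ (Set.mem_insert_of_mem _ rfl))
    refine mk_le_mk.2 ⟨pairModulus_le.2 ⟨h1, h3, ?_⟩, h2⟩
    have := Submodule.sub_mem _ h4 h2
    rwa [sub_sub_sub_cancel_left] at this
  · apply h.2
    rintro s (rfl | rfl)
    · refine mk_le_mk.2 ⟨le_pairModulus_left _ _ _ _, ?_⟩
      rw [sub_self]
      exact Submodule.zero_mem _
    · exact mk_le_mk.2 ⟨le_pairModulus_right _ _ _ _, sub_mem_pairModulus _ _ _ _⟩

theorem mk_self_le_mk_iff {z : B} {p q : (Submodule A B)ˣ} : mk z p ⊴ mk z q ↔ q ≤ p := by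
  rw [mk_le_mk, sub_self]
  exact and_iff_left (Submodule.zero_mem _)

theorem isJoin_pair_iff {z : B} {p q γ : (Submodule A B)ˣ} :
    IsJoin {mk z p, mk z q} (mk z γ) ↔ p ⊓ q = γ := by
  constructor
  · rintro ⟨h1, h2⟩
    have hp := mk_self_le_mk_iff.1 (h1 _ (Set.mem_insert _ _))
    have hq := mk_self_le_mk_iff.1 (h1 _ (Set.mem_insert_of_mem _ rfl))
    refine le_antisymm (mk_self_le_mk_iff.1 (h2 _ ?_)) (le_inf hp hq)
    rintro s (rfl | rfl)
    · exact mk_self_le_mk_iff.2 inf_le_left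
    · exact mk_self_le_mk_iff.2 inf_le_right
  · rintro rfl
    refine ⟨?_, fun u hu => ?_⟩
    · rintro s (rfl | rfl)
      · exact mk_self_le_mk_iff.2 inf_le_left
      · exact mk_self_le_mk_iff.2 inf_le_right
    · obtain ⟨u, η, rfl⟩ := exists_mk u
      obtain ⟨h1, h2⟩ := mk_le_mk.1 (hu _ (Set.mem_insert _ _))
      obtain ⟨h3, h4⟩ := mk_le_mk.1 (hu _ (Set.mem_insert_of_mem _ rfl))
      exact mk_le_mk.2 ⟨le_inf h1 h3, mem_inf.2 ⟨h2, h4⟩⟩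

theorem mk_mem_cell_iff {x y z : B} {α β γ : (Submodule A B)ˣ} :
    mk z γ ∈ cell (mk x α) (mk y β) ↔
      γ ≤ pairModulus x y α β ∧ x - z ∈ (pairModulus x y α β : Submodule A B) ∧
        pairModulus x z α γ ⊓ pairModulus y z β γ = γ := by
  have h1 : mk x (pairModulus x z α γ) = mk z (pairModulus x z α γ) :=
    mk_eq_mk.2 ⟨rfl, sub_mem_pairModulus _ _ _ _⟩
  have h2 : mk y (pairModulus y z β γ) = mk z (pairModulus y z β γ) :=
    mk_eq_mk.2 ⟨rfl, sub_mem_pairModulus _ _ _ _⟩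
  rw [cell, Set.mem_ofPred_eq, meet_mk, meet_mk, meet_mk, h1, h2, isJoin_pair_iff, mk_le_mk,
    and_assoc]

/-- The moduli of `x ∧ z` and `y ∧ z` add up to the modulus of `x ∧ y` if `z ∈ [x, y]`. -/
theorem pairModulus_sup_pairModulus {x y z : B} {α β γ : (Submodule A B)ˣ}
    (hz : mk z γ ∈ cell (mk x α) (mk y β)) :
    pairModulus x z α γ ⊔ pairModulus y z β γ = pairModulus x y α β := by
  obtain ⟨h1, h2, -⟩ := mk_mem_cell_iff.1 hz
  apply le_antisymm
  · refine sup_le (pairModulus_le.2 ⟨le_pairModulus_left _ _ _ _, h1, h2⟩)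
      (pairModulus_le.2 ⟨le_pairModulus_right _ _ _ _, h1, ?_⟩)
    have := Submodule.sub_mem _ h2 (sub_mem_pairModulus x y α β)
    rwa [sub_sub_sub_cancel_left] at this
  · refine pairModulus_le.2 ⟨(le_pairModulus_left _ _ _ _).trans le_sup_left,
      (le_pairModulus_left _ _ _ _).trans le_sup_right, ?_⟩
    have := Submodule.sub_mem _ (mem_sup_left (β := pairModulus y z β γ)
      (sub_mem_pairModulus x z α γ)) (mem_sup_right (sub_mem_pairModulus y z β γ))
    rwa [sub_sub_sub_cancel_right] at this

theorem mk_zero_mul (α β : (Submodule A B)ˣ) : mk 0 α * mk 0 β = mk 0 (α * β) := by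
  rw [mul_mk, addGen_zero, addGen_zero, mul_zero, mul_comm β, sup_idem]

theorem mk_zero_inv (α : (Submodule A B)ˣ) : (mk 0 α)⁻¹ = mk 0 α⁻¹ := by
  rw [inv_mk 0 0 α (Submodule.zero_mem _), addGen_zero, pow_two, mul_inv, mul_inv_cancel_left]
  rw [addGen_zero, inv_mul_cancel, mul_zero, zero_sub]
  exact Submodule.neg_mem _ one_mem_coe_one

theorem qdist_mk (x y : B) (α β : (Submodule A B)ˣ) :
    qdist (mk x α) (mk y β) =
      mk 0 (α * β * (pairModulus x y α β * pairModulus x y α β)⁻¹) := by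
  rw [qdist, meet_mk, ep_mk, ep_mk, ep_mk, mk_zero_mul, mk_zero_mul, mk_zero_inv, mk_zero_mul]

/-! ### The residue structure is locally faithfully full -/

/-- A point `z` of a cell `[x, y]` is determined by `p = e⁺(x ∧ z)` and `q = e⁺(y ∧ z)`, and
`d(x, z) = α q p⁻¹ μ⁻¹`, where `α = e⁺(x)` and `μ = e⁺(x ∧ y)`. -/
theorem dist_eq_of_mem_cell {x y z : B} {α β γ : (Submodule A B)ˣ}
    (hz : mk z γ ∈ cell (mk x α) (mk y β)) :
    α * γ * (pairModulus x z α γ * pairModulus x z α γ)⁻¹ =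
      α * pairModulus y z β γ * (pairModulus x z α γ)⁻¹ * (pairModulus x y α β)⁻¹ := by
  have h1 := pairModulus_sup_pairModulus hz
  have h2 := (mk_mem_cell_iff.1 hz).2.2
  have h3 := inf_mul_sup (pairModulus x z α γ) (pairModulus y z β γ)
  rw [h1, h2] at h3
  have h4 := eq_mul_inv_of_mul_eq h3
  set p := pairModulus x z α γ
  set q := pairModulus y z β γ
  set μ := pairModulus x y α β
  calc α * γ * (p * p)⁻¹ = α * (p * q * μ⁻¹) * (p⁻¹ * p⁻¹) := by rw [← h4, mul_inv]
    _ = α * q * p⁻¹ * μ⁻¹ * (p * p⁻¹) := by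
        ac_rfl
    _ = _ := by rw [mul_inv_cancel, mul_one]

/-- In a commutative `l`-group, `p` and `q` are determined by their sum and their quotient. -/
theorem eq_mul_inv_of_sup_eq {p q μ e : (Submodule A B)ˣ} (h1 : p ⊔ q = μ) (h2 : q = e * p) :
    p = μ * (1 ⊔ e)⁻¹ := by
  rw [eq_mul_inv_iff_mul_eq, mul_sup, mul_one, mul_comm p e, ← h2, h1]

theorem isLFF : IsLFF (Residue A) := by
  intro x y
  obtain ⟨x, α, rfl⟩ := exists_mk x
  obtain ⟨y, β, rfl⟩ := exists_mk y
  rw [qdist_mk x y]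
  set μ := pairModulus x y α β with hμ
  have hαμ : α ≤ μ := le_pairModulus_left _ _ _ _
  have hβμ : β ≤ μ := le_pairModulus_right _ _ _ _
  refine ⟨?_, ?_, ?_⟩
  · intro z hz
    obtain ⟨z, γ, rfl⟩ := exists_mk z
    rw [qdist_mk]
    have h3 : ∀ γ : (Submodule A B)ˣ, (mk 0 γ : Residue A) + mk 0 γ = mk 0 γ :=
      fun γ => mk_add_self.2 (Submodule.zero_mem _)
    refine ⟨h3 _, ?_, ?_⟩
    · rw [eps_eq, mk_self_le_mk_iff, ← div_eq_mul_inv, div_le_one']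
      exact mul_le_mul' (le_pairModulus_left _ _ _ _) (le_pairModulus_right _ _ _ _)
    · have h1 := pairModulus_sup_pairModulus hz
      rw [mk_self_le_mk_iff, dist_eq_of_mem_cell hz, ← hμ, mul_inv, ← mul_assoc]
      refine mul_le_mul_left ?_ _
      rw [mul_assoc, mul_assoc]
      refine mul_le_mul_right ?_ _
      rw [le_mul_inv_iff_mul_le, mul_right_comm, mul_inv_le_iff_le_mul]
      refine mul_le_mul' (le_pairModulus_left _ _ _ _) ?_
      rw [hμ, ← h1]
      exact le_sup_left
  · intro z hz z' hz' h
    obtain ⟨z, γ, rfl⟩ := exists_mk z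
    obtain ⟨z', γ', rfl⟩ := exists_mk z'
    rw [qdist_mk, qdist_mk, mk_zero_inj, dist_eq_of_mem_cell hz, dist_eq_of_mem_cell hz',
      mul_left_inj, mul_assoc, mul_assoc, mul_right_inj] at h
    have h1 := pairModulus_sup_pairModulus hz
    have h1' := pairModulus_sup_pairModulus hz'
    have h2 := (mk_mem_cell_iff.1 hz).2.2
    have h2' := (mk_mem_cell_iff.1 hz').2.2
    have hx := sub_mem_pairModulus x z α γ
    have hx' := sub_mem_pairModulus x z' α γ'
    have hy := sub_mem_pairModulus y z β γ
    have hy' := sub_mem_pairModulus y z' β γ'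
    set p := pairModulus x z α γ
    set q := pairModulus y z β γ
    set p' := pairModulus x z' α γ'
    set q' := pairModulus y z' β γ'
    have hp : p = p' := by
      rw [eq_mul_inv_of_sup_eq h1 (inv_mul_cancel_right q p).symm, h,
        ← eq_mul_inv_of_sup_eq h1' (inv_mul_cancel_right q' p').symm]
    rw [← hp, mul_left_inj] at h
    rw [← hp, ← h] at h2'
    rw [← hp] at hx'
    rw [← h] at hy'
    rw [← h2', ← h2, mk_eq_mk]
    refine ⟨rfl, mem_inf.2 ⟨?_, ?_⟩⟩
    · have := Submodule.sub_mem _ hx' hx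
      rwa [sub_sub_sub_cancel_left] at this
    · have := Submodule.sub_mem _ hy' hy
      rwa [sub_sub_sub_cancel_left] at this
  · rintro δ ⟨h1, h2, h3⟩
    obtain ⟨δ, rfl⟩ := add_idem_iff.1 h1
    rw [eps_eq, mk_self_le_mk_iff] at h2
    rw [mk_self_le_mk_iff] at h3
    let e := δ * μ * α⁻¹
    let p := μ * (1 ⊔ e)⁻¹
    let q := e * p
    have hpq : p ⊔ q = μ := by
      change p ⊔ e * p = μ
      nth_rewrite 1 [← one_mul p]
      rw [← sup_mul, mul_comm]
      exact inv_mul_cancel_right _ _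
    have hαe : α * e = δ * μ := by
      change α * (δ * μ * α⁻¹) = _
      rw [mul_comm, inv_mul_cancel_right]
    have hαp : α ≤ p := by
      rw [le_mul_inv_iff_mul_le, mul_sup, mul_one, hαe]
      exact sup_le hαμ (mul_le_of_le_one_left' h2)
    have hβq : β ≤ q := by
      change β ≤ e * (μ * (1 ⊔ e)⁻¹)
      rw [← mul_assoc, le_mul_inv_iff_mul_le, mul_sup, mul_one]
      refine sup_le ?_ ?_
      · change β ≤ δ * μ * α⁻¹ * μ
        rw [mul_right_comm, le_mul_inv_iff_mul_le, mul_comm β, mul_assoc δ]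
        rwa [mul_inv_le_iff_le_mul] at h3
      · rw [mul_comm]
        exact mul_le_mul_right hβμ _
    obtain ⟨s, hs, t, ht, hst⟩ := Submodule.mem_sup.1
      (show x - y ∈ (p : Submodule A B) ⊔ q by
        rw [← coe_sup, hpq]
        exact sub_mem_pairModulus _ _ _ _)
    have hxz : x - (x - s) = s := by ring
    have hyz : y - (x - s) = -t := by rw [← sub_eq_zero]; linear_combination hst
    have hp' : pairModulus x (x - s) α (p ⊓ q) ≤ p :=
      pairModulus_le.2 ⟨hαp, inf_le_left, by rwa [hxz]⟩
    have hq' : pairModulus y (x - s) β (p ⊓ q) ≤ q :=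
      pairModulus_le.2 ⟨hβq, inf_le_right, by rw [hyz]; exact Submodule.neg_mem _ ht⟩
    have hcell : mk (x - s) (p ⊓ q) ∈ cell (mk x α) (mk y β) := by
      refine mk_mem_cell_iff.2 ⟨?_, ?_, ?_⟩
      · rw [← hμ, ← hpq]
        exact inf_le_left.trans le_sup_left
      · rw [← hμ, ← hpq, hxz]
        exact mem_sup_left hs
      · exact le_antisymm (inf_le_inf hp' hq')
          (le_inf (le_pairModulus_right _ _ _ _) (le_pairModulus_right _ _ _ _))
    refine ⟨mk (x - s) (p ⊓ q), hcell, ?_⟩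
    have h4 := pairModulus_sup_pairModulus hcell
    have h5 := (mk_mem_cell_iff.1 hcell).2.2
    -- By modularity, `p' ≤ p` and `q' ≤ q` with equal sums and equal intersections are equalities.
    have hp_eq : pairModulus x (x - s) α (p ⊓ q) = p := by
      refine eq_of_le_of_inf_le_of_sup_le (z := q) hp' ?_ ?_
      · exact le_inf (le_pairModulus_right _ _ _ _) inf_le_right
      · rw [hpq, hμ, ← h4]
        exact sup_le_sup_left hq' _
    have hq_eq : pairModulus y (x - s) β (p ⊓ q) = q := by
      refine eq_of_le_of_inf_le_of_sup_le (z := p) hq' ?_ ?_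
      · rw [inf_comm]
        exact le_inf (le_pairModulus_right _ _ _ _) inf_le_left
      · rw [sup_comm q, hpq, hμ, ← h4, sup_comm]
        exact sup_le_sup_left hp' _
    rw [qdist_mk, dist_eq_of_mem_cell hcell, hp_eq, hq_eq, mk_zero_inj]
    change α * (e * p) * p⁻¹ * μ⁻¹ = δ
    rw [← mul_assoc, mul_inv_cancel_right, hαe, mul_inv_cancel_right]

/-! ### Medians -/

/-- The moduli of the three pairwise meets satisfy the ultrametric inequality. -/
theorem pairModulus_le_sup (x y z : B) (α β γ : (Submodule A B)ˣ) :
    pairModulus x z α γ ≤ pairModulus x y α β ⊔ pairModulus y z β γ := by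
  refine pairModulus_le.2 ⟨(le_pairModulus_left _ _ _ _).trans le_sup_left,
    (le_pairModulus_right _ _ _ _).trans le_sup_right, ?_⟩
  rw [← sub_add_sub_cancel x y z]
  exact Submodule.add_mem_sup (sub_mem_pairModulus _ _ _ _) (sub_mem_pairModulus _ _ _ _)

theorem exists_medianCongr (x₁ x₂ x₃ : B) (α₁ α₂ α₃ : (Submodule A B)ˣ) :
    ∃ x, MedianCongr x₁ x₂ x₃ α₁ α₂ α₃ x := by
  have h12 := sub_mem_pairModulus x₁ x₂ α₁ α₂
  have h13 := sub_mem_pairModulus x₁ x₃ α₁ α₃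
  have h23 := sub_mem_pairModulus x₂ x₃ α₂ α₃
  have hle := pairModulus_le_sup x₁ x₃ x₂ α₁ α₃ α₂
  rw [pairModulus_comm x₃ x₂] at hle
  set μ₁₂ := pairModulus x₁ x₂ α₁ α₂
  set μ₁₃ := pairModulus x₁ x₃ α₁ α₃
  set μ₂₃ := pairModulus x₂ x₃ α₂ α₃
  -- The Chinese remainder theorem for the moduli `μ₁₂ ∩ μ₁₃` and `μ₂₃`.
  have h : x₁ - x₂ ∈ ((μ₁₂ ⊓ μ₁₃ ⊔ μ₂₃ : (Submodule A B)ˣ) : Submodule A B) := by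
    rw [sup_inf_right]
    exact mem_inf.2 ⟨mem_sup_left h12, hle h12⟩
  obtain ⟨s, hs, t, ht, hst⟩ := Submodule.mem_sup.1 h
  obtain ⟨hs1, hs2⟩ := mem_inf.1 hs
  have e1 : x₁ - s - x₁ = -s := by ring
  have e2 : x₁ - s - x₂ = t := by linear_combination -hst
  refine ⟨x₁ - s, ⟨?_, ?_⟩, ⟨?_, ?_⟩, ?_, ?_⟩
  · rw [e1]
    exact Submodule.neg_mem _ hs1
  · rw [← sub_add_sub_cancel _ x₁ x₂, e1]
    exact Submodule.add_mem _ (Submodule.neg_mem _ hs1) h12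
  · rw [e1]
    exact Submodule.neg_mem _ hs2
  · rw [← sub_add_sub_cancel _ x₁ x₃, e1]
    exact Submodule.add_mem _ (Submodule.neg_mem _ hs2) h13
  · rw [e2]
    exact ht
  · rw [← sub_add_sub_cancel _ x₂ x₃, e2]
    exact Submodule.add_mem _ ht h23

theorem isMedianPoint_of_medianCongr {x₁ x₂ x₃ x : B} {α₁ α₂ α₃ : (Submodule A B)ˣ}
    (hx : MedianCongr x₁ x₂ x₃ α₁ α₂ α₃ x) :
    IsMedianPoint (mk x₁ α₁) (mk x₂ α₂) (mk x₃ α₃)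
      (mk x (pairModulus x₁ x₂ α₁ α₂ ⊓ pairModulus x₁ x₃ α₁ α₃ ⊓ pairModulus x₂ x₃ α₂ α₃)) := by
  obtain ⟨⟨h1, h2⟩, ⟨h3, h4⟩, h5, h6⟩ := hx
  have l1 := le_pairModulus_left x₁ x₂ α₁ α₂
  have l2 := le_pairModulus_right x₁ x₂ α₁ α₂
  have l3 := le_pairModulus_left x₁ x₃ α₁ α₃
  have l4 := le_pairModulus_right x₁ x₃ α₁ α₃
  have l5 := le_pairModulus_left x₂ x₃ α₂ α₃
  have l6 := le_pairModulus_right x₂ x₃ α₂ α₃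
  have e13 := pairModulus_comm x₁ x₃ α₁ α₃
  set μ₁₂ := pairModulus x₁ x₂ α₁ α₂
  set μ₁₃ := pairModulus x₁ x₃ α₁ α₃
  set μ₂₃ := pairModulus x₂ x₃ α₂ α₃
  set α := μ₁₂ ⊓ μ₁₃ ⊓ μ₂₃
  have a1 : α ≤ μ₁₂ := inf_le_left.trans inf_le_left
  have a2 : α ≤ μ₁₃ := inf_le_left.trans inf_le_right
  have a3 : α ≤ μ₂₃ := inf_le_right
  have key : ∀ {y : B} {β μ : (Submodule A B)ˣ}, β ≤ μ → α ≤ μ → x - y ∈ (μ : Submodule A B) →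
      pairModulus y x β α ≤ μ := by
    intro y β μ hβ hα hxy
    refine pairModulus_le.2 ⟨hβ, hα, ?_⟩
    rw [← neg_sub]
    exact Submodule.neg_mem _ hxy
  have swap : ∀ {y : B} {μ : (Submodule A B)ˣ}, x - y ∈ (μ : Submodule A B) →
      y - x ∈ (μ : Submodule A B) := by
    intro y μ h
    rw [← neg_sub]
    exact Submodule.neg_mem _ h
  refine ⟨mk_mem_cell_iff.2 ⟨a1, swap h1, ?_⟩, mk_mem_cell_iff.2 ⟨a3, swap h5, ?_⟩,
    mk_mem_cell_iff.2 ⟨?_, ?_, ?_⟩⟩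
  · refine le_antisymm (le_inf (le_inf ?_ ?_) ?_)
      (le_inf (le_pairModulus_right _ _ _ _) (le_pairModulus_right _ _ _ _))
    · exact inf_le_left.trans (key l1 a1 h1)
    · exact inf_le_left.trans (key l3 a2 h3)
    · exact inf_le_right.trans (key l5 a3 h5)
  · refine le_antisymm (le_inf (le_inf ?_ ?_) ?_)
      (le_inf (le_pairModulus_right _ _ _ _) (le_pairModulus_right _ _ _ _))
    · exact inf_le_left.trans (key l2 a1 h2)
    · exact inf_le_right.trans (key l4 a2 h4)
    · exact inf_le_left.trans (key l5 a3 h5)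
  · rwa [← e13]
  · rw [← e13]
    exact swap h4
  · refine le_antisymm (le_inf (le_inf ?_ ?_) ?_)
      (le_inf (le_pairModulus_right _ _ _ _) (le_pairModulus_right _ _ _ _))
    · exact inf_le_right.trans (key l1 a1 h1)
    · exact inf_le_left.trans (key l4 a2 h4)
    · exact inf_le_left.trans (key l6 a3 h6)

/-- The median is unique because of the self-duality
`(a + b) ∩ (a + c) ∩ (b + c) = (a ∩ b) + (a ∩ c) + (b ∩ c)` of medians in a distributive lattice,
applied to the moduli of the meets of a median point with the three given points. -/
theorem eq_of_isMedianPoint {x₁ x₂ x₃ x : B} {α₁ α₂ α₃ : (Submodule A B)ˣ}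
    (hx : MedianCongr x₁ x₂ x₃ α₁ α₂ α₃ x) {m : Residue A}
    (hm : IsMedianPoint (mk x₁ α₁) (mk x₂ α₂) (mk x₃ α₃) m) :
    m = mk x
      (pairModulus x₁ x₂ α₁ α₂ ⊓ pairModulus x₁ x₃ α₁ α₃ ⊓ pairModulus x₂ x₃ α₂ α₃) := by
  obtain ⟨z, γ, rfl⟩ := exists_mk m
  obtain ⟨hm1, hm2, hm3⟩ := hm
  have s1 := pairModulus_sup_pairModulus hm1
  have s2 := pairModulus_sup_pairModulus hm2
  have s3 := pairModulus_sup_pairModulus hm3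
  obtain ⟨-, b1, c1⟩ := mk_mem_cell_iff.1 hm1
  obtain ⟨-, b2, c2⟩ := mk_mem_cell_iff.1 hm2
  obtain ⟨-, b3, c3⟩ := mk_mem_cell_iff.1 hm3
  rw [pairModulus_comm x₃ x₁] at s3 b3
  obtain ⟨⟨h1, -⟩, ⟨-, h4⟩, h5, -⟩ := hx
  set p₁ := pairModulus x₁ z α₁ γ
  set p₂ := pairModulus x₂ z α₂ γ
  set p₃ := pairModulus x₃ z α₃ γ
  rw [← s1] at b1 h1
  rw [← s2] at b2 h5
  rw [← s3] at b3 h4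
  rw [← s1, ← s2, ← s3]
  have hγ : γ = (p₁ ⊔ p₂) ⊓ (p₃ ⊔ p₁) ⊓ (p₂ ⊔ p₃) := by
    have e : (p₁ ⊔ p₂) ⊓ (p₃ ⊔ p₁) = p₁ ⊔ p₂ ⊓ p₃ := by rw [sup_comm p₃, ← sup_inf_left]
    rw [e, c2, inf_sup_right, inf_sup_left, c1, inf_comm p₁ p₃, c3, sup_idem, left_eq_sup]
    exact inf_le_left
  refine mk_eq_mk.2 ⟨hγ, ?_⟩
  rw [hγ, ← neg_sub]
  refine Submodule.neg_mem _ (mem_inf.2 ⟨mem_inf.2 ⟨?_, ?_⟩, ?_⟩)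
  · rw [← sub_add_sub_cancel x x₁ z]
    exact Submodule.add_mem _ h1 b1
  · rw [← sub_add_sub_cancel x x₃ z]
    exact Submodule.add_mem _ h4 b3
  · rw [← sub_add_sub_cancel x x₂ z]
    exact Submodule.add_mem _ h5 b2

theorem isMedianQSring : IsMedianQSring (Residue A) := by
  intro x₁ x₂ x₃
  obtain ⟨x₁, α₁, rfl⟩ := exists_mk x₁
  obtain ⟨x₂, α₂, rfl⟩ := exists_mk x₂
  obtain ⟨x₃, α₃, rfl⟩ := exists_mk x₃
  obtain ⟨x, hx⟩ := exists_medianCongr x₁ x₂ x₃ α₁ α₂ α₃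
  exact ⟨_, isMedianPoint_of_medianCongr hx, fun m hm => eq_of_isMedianPoint hx hm⟩

theorem isJoin_of_medianCongr {x₁ x₂ x₃ x : B} {α₁ α₂ α₃ : (Submodule A B)ˣ}
    (hx : MedianCongr x₁ x₂ x₃ α₁ α₂ α₃ x) :
    IsJoin {meet (mk x₁ α₁) (mk x₂ α₂), meet (mk x₁ α₁) (mk x₃ α₃), meet (mk x₂ α₂) (mk x₃ α₃)}
      (mk x (pairModulus x₁ x₂ α₁ α₂ ⊓ pairModulus x₁ x₃ α₁ α₃ ⊓ pairModulus x₂ x₃ α₂ α₃)) := by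
  obtain ⟨⟨h1, -⟩, ⟨h3, -⟩, h5, -⟩ := hx
  rw [meet_mk, meet_mk, meet_mk, ← mk_eq_mk.2 ⟨rfl, h1⟩, ← mk_eq_mk.2 ⟨rfl, h3⟩,
    ← mk_eq_mk.2 ⟨rfl, h5⟩]
  refine ⟨?_, fun u hu => ?_⟩
  · rintro s (rfl | rfl | rfl)
    · exact mk_self_le_mk_iff.2 (inf_le_left.trans inf_le_left)
    · exact mk_self_le_mk_iff.2 (inf_le_left.trans inf_le_right)
    · exact mk_self_le_mk_iff.2 inf_le_right
  · obtain ⟨u, η, rfl⟩ := exists_mk u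
    obtain ⟨u1, v1⟩ := mk_le_mk.1 (hu _ (Or.inl rfl))
    obtain ⟨u2, v2⟩ := mk_le_mk.1 (hu _ (Or.inr (Or.inl rfl)))
    obtain ⟨u3, v3⟩ := mk_le_mk.1 (hu _ (Or.inr (Or.inr rfl)))
    exact mk_le_mk.2 ⟨le_inf (le_inf u1 u2) u3, mem_inf.2 ⟨mem_inf.2 ⟨v1, v2⟩, v3⟩⟩

theorem medianCongr_iff {x₁ x₂ x₃ x : B} {α₁ α₂ α₃ : (Submodule A B)ˣ}
    (hx : MedianCongr x₁ x₂ x₃ α₁ α₂ α₃ x) (y : B) :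
    MedianCongr x₁ x₂ x₃ α₁ α₂ α₃ y ↔
      y - x ∈ ((pairModulus x₁ x₂ α₁ α₂ ⊓ pairModulus x₁ x₃ α₁ α₃ ⊓ pairModulus x₂ x₃ α₂ α₃ :
        (Submodule A B)ˣ) : Submodule A B) := by
  obtain ⟨⟨h1, h2⟩, ⟨h3, h4⟩, h5, h6⟩ := hx
  have key : ∀ {z : B} {μ : (Submodule A B)ˣ}, x - z ∈ (μ : Submodule A B) →
      (y - z ∈ (μ : Submodule A B) ↔ y - x ∈ (μ : Submodule A B)) := by
    intro z μ h
    rw [← sub_add_sub_cancel y x z]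
    exact Submodule.add_mem_iff_left _ h
  rw [MedianCongr, key h1, key h2, key h3, key h4, key h5, key h6, mem_inf, mem_inf, and_self,
    and_self, and_self, and_assoc]

/-! ### The completion and its approximations by elements of `B` -/

/-- The element of `Λ₊` given by an invertible submodule `γ ⊆ A`. -/
def posOf (γ : (Submodule A B)ˣ) (h : γ ≤ 1) : PosIdem (Residue A) :=
  ⟨mk 0 γ, mk_add_self.2 (Submodule.zero_mem _), mk_self_le_mk_iff.2 h⟩

theorem exists_posOf (α : PosIdem (Residue A)) : ∃ γ h, α = posOf γ h := by
  obtain ⟨α, h1, h2⟩ := α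
  obtain ⟨γ, rfl⟩ := add_idem_iff.1 h1
  exact ⟨γ, mk_self_le_mk_iff.1 h2, rfl⟩

theorem posOf_le {γ δ : (Submodule A B)ˣ} {hγ : γ ≤ 1} {hδ : δ ≤ 1} :
    (posOf γ hγ).1 ⊴ (posOf δ hδ).1 ↔ δ ≤ γ := mk_self_le_mk_iff

theorem qv_mk (x : B) (α : (Submodule A B)ˣ) : qv (mk x α) = mk 0 (addGen α x) := by
  rw [qv, eps_eq, mul_mk, addGen_zero, zero_mul, one_mul, mul_one, sup_eq_left.2 (le_addGen α x)]

/-- The element `b` of `B` represents the component at `γ ⊆ A` of the element `φ` of the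
completion of `B`. -/
def IsApprox (φ : ResRing (Residue A)) (b : B) (γ : (Submodule A B)ˣ) : Prop :=
  ∃ h : γ ≤ 1, φ (posOf γ h) = mk b γ

theorem exists_isApprox (φ : ResRing (Residue A)) {γ : (Submodule A B)ˣ} (h : γ ≤ 1) :
    ∃ b, IsApprox φ b γ := by
  obtain ⟨b, δ, hb⟩ := exists_mk (φ (posOf γ h))
  have h1 := φ.ep_apply (posOf γ h)
  rw [hb, ep_mk] at h1
  obtain rfl := mk_zero_inj.1 h1
  exact ⟨b, h, hb⟩

namespace IsApprox

variable {φ ψ : ResRing (Residue A)} {b c : B} {α γ δ : (Submodule A B)ˣ}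

theorem le_one (h : IsApprox φ b γ) : γ ≤ 1 := h.1

theorem congr_iff (h : IsApprox φ b γ) : IsApprox φ c γ ↔ c - b ∈ (γ : Submodule A B) := by
  obtain ⟨h0, h1⟩ := h
  constructor
  · rintro ⟨_, h2⟩
    have h2 := h1.symm.trans h2
    rw [mk_eq_mk] at h2
    rw [← neg_sub]
    exact Submodule.neg_mem _ h2.2
  · intro h2
    exact ⟨h0, h1.trans (mk_eq_mk.2 ⟨rfl, h2⟩).symm⟩

theorem mono (h : IsApprox φ b δ) (hδ : δ ≤ γ) (hγ : γ ≤ 1) : IsApprox φ b γ := by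
  obtain ⟨c, hc⟩ := exists_isApprox φ hγ
  obtain ⟨h0, h1⟩ := h
  have h2 := φ.mono _ _ (posOf_le (hγ := hγ) (hδ := h0).2 hδ)
  rw [h1, hc.2, mk_le_mk] at h2
  rw [hc.congr_iff, ← neg_sub]
  exact Submodule.neg_mem _ h2.2

theorem add (h : IsApprox φ b γ) (h' : IsApprox ψ c γ) : IsApprox (φ + ψ) (b + c) γ := by
  refine ⟨h.1, ?_⟩
  rw [ResRing.add_apply, h.2, h'.2, add_mk, sup_idem]

theorem neg (h : IsApprox φ b γ) : IsApprox (-φ) (-b) γ := by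
  refine ⟨h.1, ?_⟩
  rw [ResRing.neg_apply, h.2, neg_mk]

/-- Multiplication of approximations: if `b, c ∈ ν` represent `φ` and `ψ` modulo `α ν⁻¹`, then
`b c` represents `φ ψ` modulo `α`. -/
theorem mul {ν : (Submodule A B)ˣ} (hν : 1 ≤ ν) (hα : α ≤ 1) (hb : b ∈ (ν : Submodule A B))
    (hc : c ∈ (ν : Submodule A B)) (h : IsApprox φ b (α * ν⁻¹))
    (h' : IsApprox ψ c (α * ν⁻¹)) : IsApprox (φ * ψ) (b * c) α := by
  obtain ⟨γ₀, hγ₀⟩ := ResRing.mul_apply φ ψ (posOf α hα)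
  obtain ⟨δ₀, hδ₀, rfl⟩ := exists_posOf γ₀
  have hαν : α * ν⁻¹ ≤ ν := by
    rw [mul_inv_le_iff_le_mul]
    exact hα.trans (one_le_mul hν hν)
  have hδ : α * ν⁻¹ ⊓ δ₀ ≤ 1 := inf_le_right.trans hδ₀
  obtain ⟨b', hb'⟩ := exists_isApprox φ hδ
  obtain ⟨c', hc'⟩ := exists_isApprox ψ hδ
  have hbb := h.congr_iff.1 (hb'.mono inf_le_left h.le_one)
  have hcc := h'.congr_iff.1 (hc'.mono inf_le_left h.le_one)
  have hb'ν : b' ∈ (ν : Submodule A B) := by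
    rw [← sub_add_cancel b' b]
    exact Submodule.add_mem _ (hαν hbb) hb
  have hc'ν : c' ∈ (ν : Submodule A B) := by
    rw [← sub_add_cancel c' c]
    exact Submodule.add_mem _ (hαν hcc) hc
  have key : ∀ {x : B}, x ∈ (ν : Submodule A B) →
      (α * ν⁻¹ ⊓ δ₀) * addGen (α * ν⁻¹ ⊓ δ₀) x ≤ α := by
    intro x hx
    have h1 : addGen (α * ν⁻¹ ⊓ δ₀) x ≤ ν := addGen_le.2 ⟨inf_le_left.trans hαν, hx⟩
    have h2 := mul_le_mul' (inf_le_left : α * ν⁻¹ ⊓ δ₀ ≤ α * ν⁻¹) h1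
    rwa [inv_mul_cancel_right] at h2
  have h1 := hγ₀ (posOf _ hδ) (posOf_le.2 inf_le_right)
  rw [hb'.2, hc'.2, mul_mk] at h1
  refine ⟨hα, h1.trans ?_⟩
  change _ + mk 0 α = _
  rw [add_mk, add_zero, sup_eq_right.2 (sup_le (key hc'ν) (key hb'ν)), mk_eq_mk]
  refine ⟨rfl, ?_⟩
  have e : b' * c' - b * c = (b' - b) * c' + (c' - c) * b := by ring
  have h2 := mul_mem_mul hbb hc'ν
  have h3 := mul_mem_mul hcc hb
  rw [inv_mul_cancel_right] at h2 h3
  rw [e]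
  exact Submodule.add_mem _ h2 h3

end IsApprox

theorem isApprox_zero {γ : (Submodule A B)ˣ} (h : γ ≤ 1) :
    IsApprox (0 : ResRing (Residue A)) 0 γ := ⟨h, rfl⟩

theorem isApprox_one {γ : (Submodule A B)ˣ} (h : γ ≤ 1) :
    IsApprox (1 : ResRing (Residue A)) 1 γ := by
  refine ⟨h, QS.eq_of_ep_eq (ResRing.oneAt_mul _) ?_ ?_⟩
  · rw [mk_mul_self, mul_one, sub_self]
    refine ⟨le_antisymm (addGen_le.2 ⟨h, one_mem_coe_one⟩) ?_, Submodule.zero_mem _⟩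
    exact Submodule.one_le.2 (mem_addGen γ 1)
  · rw [ep_mk]
    exact ResRing.ep_oneAt _

theorem ext_isApprox {φ ψ : ResRing (Residue A)}
    (h : ∀ γ : (Submodule A B)ˣ, γ ≤ 1 → ∃ b, IsApprox φ b γ ∧ IsApprox ψ b γ) : φ = ψ := by
  ext α
  obtain ⟨γ, hγ, rfl⟩ := exists_posOf α
  obtain ⟨b, h1, h2⟩ := h γ hγ
  exact h1.2.trans h2.2.symm

theorem exists_bound (φ : ResRing (Residue A)) :
    ∃ ν : (Submodule A B)ˣ, 1 ≤ ν ∧ ∀ b γ, IsApprox φ b γ → b ∈ (ν : Submodule A B) := by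
  obtain ⟨c, hc⟩ := exists_isApprox φ (le_refl (1 : (Submodule A B)ˣ))
  refine ⟨addGen 1 c, le_addGen _ _, fun b γ hb => ?_⟩
  rw [← sub_add_cancel b c]
  exact Submodule.add_mem _
    (le_addGen 1 c (hc.congr_iff.1 (hb.mono hb.le_one _root_.le_rfl))) (mem_addGen _ _)

/-- The canonical homomorphism from `B` to its completion, `b ↦ (α ↦ b mod α)`. -/
noncomputable def ofBase (A : Subring B) [IsPruferExtension A] : B →+* ResRing (Residue A) :=
  let f : B → ResRing (Residue A) := fun b =>
    { toFun := fun α => mk b (modulus α.1)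
      ep_apply := fun α => by
        obtain ⟨γ, h, rfl⟩ := exists_posOf α
        exact ep_mk _ _
      mono := fun α β h => by
        obtain ⟨γ, hγ, rfl⟩ := exists_posOf α
        obtain ⟨δ, hδ, rfl⟩ := exists_posOf β
        exact mk_self_le_mk_iff.2 (posOf_le.1 h) }
  have hf : ∀ b (γ : (Submodule A B)ˣ), γ ≤ 1 → IsApprox (f b) b γ := fun b γ h => ⟨h, rfl⟩
  { toFun := f
    map_zero' := ext_isApprox fun γ h => ⟨0, hf 0 γ h, isApprox_zero h⟩
    map_one' := ext_isApprox fun γ h => ⟨1, hf 1 γ h, isApprox_one h⟩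
    map_add' := fun b c => ext_isApprox fun γ h =>
      ⟨b + c, hf _ γ h, (hf b γ h).add (hf c γ h)⟩
    map_mul' := fun b c => ext_isApprox fun γ h => by
      have hν : (1 : (Submodule A B)ˣ) ≤ addGen 1 b ⊔ addGen 1 c := (le_addGen 1 b).trans le_sup_left
      have hγ : γ * (addGen 1 b ⊔ addGen 1 c)⁻¹ ≤ 1 := by
        rw [mul_inv_le_iff_le_mul, one_mul]
        exact h.trans hν
      exact ⟨b * c, hf _ γ h, IsApprox.mul hν h (mem_sup_left (mem_addGen 1 b))
        (mem_sup_right (mem_addGen 1 c)) (hf b _ hγ) (hf c _ hγ)⟩ }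

theorem isApprox_ofBase (b : B) {γ : (Submodule A B)ˣ} (h : γ ≤ 1) :
    IsApprox (ofBase A b) b γ := ⟨h, rfl⟩

/-- The valuation ring `A_w` consists of the elements of the completion whose approximations lie
in `A`; it suffices to look at a single approximation. -/
theorem IsApprox.mem_valSubring {φ : ResRing (Residue A)} {b : B} {γ : (Submodule A B)ˣ}
    (h : IsApprox φ b γ) : φ ∈ valSubring (Residue A) ↔ b ∈ A := by
  have key : ∀ {c : B} {δ : (Submodule A B)ˣ} (hc : IsApprox φ c δ),
      eps ⊴ wVal φ (posOf δ hc.le_one) ↔ c ∈ A := by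
    intro c δ hc
    rw [wVal, hc.2, qv_mk, eps_eq, mk_self_le_mk_iff, addGen_le, mem_coe_one]
    exact and_iff_right hc.le_one
  constructor
  · intro hφ
    exact (key h).1 (hφ _)
  · intro hb α
    obtain ⟨δ, hδ, rfl⟩ := exists_posOf α
    obtain ⟨c, hc⟩ := exists_isApprox φ hδ
    refine (key hc).2 ?_
    have h1 := (h.mono h.le_one _root_.le_rfl).congr_iff.1 (hc.mono hδ _root_.le_rfl)
    rw [← sub_add_cancel c b]
    exact A.add_mem (mem_coe_one.1 h1) hb

theorem ofBase_mem_valSubring {b : B} : ofBase A b ∈ valSubring (Residue A) ↔ b ∈ A :=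
  (isApprox_ofBase b (le_refl (1 : (Submodule A B)ˣ))).mem_valSubring

/-- The completion of a Prüfer extension is Prüfer: an element `φ` of the completion differs from
some `b ∈ B` by an element of `A_w`, and the multiplier that works for `b` also works for `φ`. -/
theorem isPruferExtension_valSubring : IsPruferExtension (valSubring (Residue A)) where
  exists_mem φ := by
    obtain ⟨b, hb⟩ := exists_isApprox φ (le_refl (1 : (Submodule A B)ˣ))
    obtain ⟨y, hy, h1, h2⟩ := IsPruferExtension.exists_mem (A := A) b
    have ha : φ + -ofBase A b ∈ valSubring (Residue A) := by
      rw [(hb.add (isApprox_ofBase b (le_refl (1 : (Submodule A B)ˣ))).neg).mem_valSubring,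
        add_neg_cancel]
      exact A.zero_mem
    have hφ : φ = ofBase A b + (φ + -ofBase A b) := by abel
    generalize φ + -ofBase A b = a at ha hφ
    have hy' := ofBase_mem_valSubring.2 hy
    have h1' := ofBase_mem_valSubring.2 h1
    have h2' := ofBase_mem_valSubring.2 h2
    refine ⟨ofBase A y, hy', ?_, ?_⟩
    · have e : φ * ofBase A y = ofBase A (b * y) + a * ofBase A y := by
        rw [hφ, map_mul]
        ring
      rw [e]
      exact add_mem h1' (mul_mem ha hy')
    · have e : φ * (1 - φ * ofBase A y) = ofBase A (b * (1 - b * y)) + a -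
          (a * ofBase A (b * y) + a * ofBase A (b * y)) - a * a * ofBase A y := by
        rw [hφ]
        simp only [map_mul, map_sub, map_one]
        ring
      rw [e]
      exact sub_mem (sub_mem (add_mem h2' ha) (add_mem (mul_mem ha h1') (mul_mem ha h1')))
        (mul_mem (mul_mem ha ha) hy')

/-! ### Traces of submodules of the completion -/

/-- Multiplication by an element of `A_w` is compatible with a fixed precision `γ` of the second
factor, if the first factor is represented precisely enough. -/
theorem IsApprox.exists_mul {φ ψ : ResRing (Residue A)} {b : B} {γ : (Submodule A B)ˣ}
    (hφ : φ ∈ valSubring (Residue A)) (h : IsApprox ψ b γ) :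
    ∃ δ : (Submodule A B)ˣ, δ ≤ 1 ∧ ∀ a, IsApprox φ a δ → IsApprox (φ * ψ) (a * b) γ := by
  obtain ⟨ν, hν, hb⟩ := exists_bound ψ
  have hle : γ * ν⁻¹ ≤ γ := by
    rw [mul_inv_le_iff_le_mul]
    exact le_mul_of_one_le_right' hν
  refine ⟨γ * ν⁻¹, hle.trans h.le_one, fun a ha => ?_⟩
  have haA := mem_coe_one.2 (ha.mem_valSubring.1 hφ)
  obtain ⟨c, hc⟩ := exists_isApprox ψ (hle.trans h.le_one)
  have h1 := IsApprox.mul hν h.le_one (hν haA) (hb _ _ hc) ha hc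
  rw [h1.congr_iff, ← mul_sub]
  have h2 := mul_mem_mul haA ((hc.mono hle h.le_one).congr_iff.1 h)
  rwa [one_mul] at h2

/-- The `A_w`-submodule of the elements of the completion that are represented modulo `γ` by an
element of `N`. -/
def liftSub (N : Submodule A B) (γ : (Submodule A B)ˣ) (hγ : γ ≤ 1) :
    Submodule (valSubring (Residue A)) (ResRing (Residue A)) where
  carrier := {φ | ∃ b ∈ N, IsApprox φ b γ}
  zero_mem' := ⟨0, N.zero_mem, isApprox_zero hγ⟩
  add_mem' := by
    rintro φ ψ ⟨b, hb, hφ⟩ ⟨c, hc, hψ⟩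
    exact ⟨b + c, N.add_mem hb hc, hφ.add hψ⟩
  smul_mem' := by
    rintro ⟨a, ha⟩ φ ⟨b, hb, hφ⟩
    obtain ⟨δ, hδ, h⟩ := hφ.exists_mul ha
    obtain ⟨a', ha'⟩ := exists_isApprox a hδ
    exact ⟨a' * b, N.smul_mem (⟨a', ha'.mem_valSubring.1 ha⟩ : A) hb, h a' ha'⟩

/-- The `A`-submodule of `B` of the elements that represent, modulo `γ`, an element of the
submodule `I` of the completion. For a finitely generated `I`, this is the value of `ŵ(I)` at `γ`,
see `isWHat_iff`. -/
def trace (I : Submodule (valSubring (Residue A)) (ResRing (Residue A)))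
    (γ : (Submodule A B)ˣ) (hγ : γ ≤ 1) : Submodule A B where
  carrier := {b | ∃ φ ∈ I, IsApprox φ b γ}
  zero_mem' := ⟨0, I.zero_mem, isApprox_zero hγ⟩
  add_mem' := by
    rintro b c ⟨φ, hφ, hb⟩ ⟨ψ, hψ, hc⟩
    exact ⟨φ + ψ, I.add_mem hφ hψ, hb.add hc⟩
  smul_mem' := by
    rintro ⟨a, ha⟩ b ⟨φ, hφ, hb⟩
    have ha' := ofBase_mem_valSubring.2 ha
    obtain ⟨δ, hδ, h⟩ := hb.exists_mul ha'
    exact ⟨ofBase A a * φ, I.smul_mem (⟨ofBase A a, ha'⟩ : valSubring (Residue A)) hφ,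
      h a (isApprox_ofBase a hδ)⟩

section Trace

variable {I J : Submodule (valSubring (Residue A)) (ResRing (Residue A))}

theorem mem_trace {γ : (Submodule A B)ˣ} {hγ : γ ≤ 1} {b : B} :
    b ∈ trace I γ hγ ↔ ∃ φ ∈ I, IsApprox φ b γ := Iff.rfl

theorem trace_le_iff {γ : (Submodule A B)ˣ} {hγ : γ ≤ 1} {N : Submodule A B} :
    trace I γ hγ ≤ N ↔ (γ : Submodule A B) ≤ N ∧ I ≤ liftSub N γ hγ := by
  constructor
  · intro h
    refine ⟨fun b hb => h ⟨0, I.zero_mem, ?_⟩, fun φ hφ => ?_⟩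
    · rwa [(isApprox_zero hγ).congr_iff, sub_zero]
    · obtain ⟨b, hb⟩ := exists_isApprox φ hγ
      exact ⟨b, h ⟨φ, hφ, hb⟩, hb⟩
  · rintro ⟨h1, h2⟩ b ⟨φ, hφ, hb⟩
    obtain ⟨c, hc, hc'⟩ := h2 hφ
    rw [← sub_add_cancel b c]
    exact N.add_mem (h1 (hc'.congr_iff.1 hb)) hc

theorem le_trace {γ : (Submodule A B)ˣ} {hγ : γ ≤ 1} : (γ : Submodule A B) ≤ trace I γ hγ :=
  (trace_le_iff.1 le_rfl).1

theorem trace_mono {γ δ : (Submodule A B)ˣ} {hγ : γ ≤ 1} {hδ : δ ≤ 1} (h : δ ≤ γ) :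
    trace I δ hδ ≤ trace I γ hγ := by
  rintro b ⟨φ, hφ, hb⟩
  exact ⟨φ, hφ, hb.mono h hγ⟩

theorem trace_sup {γ δ : (Submodule A B)ˣ} {hγ : γ ≤ 1} {hδ : δ ≤ 1} (h : δ ≤ γ) :
    trace I δ hδ ⊔ γ = trace I γ hγ := by
  apply le_antisymm (sup_le (trace_mono h) le_trace)
  refine trace_le_iff.2 ⟨_root_.le_sup_right, fun φ hφ => ?_⟩
  obtain ⟨b, hb⟩ := exists_isApprox φ hδ
  exact ⟨b, Submodule.mem_sup_left ⟨φ, hφ, hb⟩, hb.mono h hγ⟩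

theorem trace_one {γ : (Submodule A B)ˣ} {hγ : γ ≤ 1} :
    trace (1 : Submodule (valSubring (Residue A)) (ResRing (Residue A))) γ hγ = 1 := by
  ext b
  rw [mem_trace, mem_one_iff_mem]
  constructor
  · rintro ⟨φ, hφ, hb⟩
    exact hb.mem_valSubring.1 (mem_one_iff_mem.1 hφ)
  · intro hb
    exact ⟨ofBase A b, mem_one_iff_mem.2 (ofBase_mem_valSubring.2 hb), isApprox_ofBase b hγ⟩

/-- `ŵ(I J)(α)` is the meet of `α` and `ŵ(I)(γ) ŵ(J)(γ)` for `γ` large enough: it suffices that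
`γ ν ⊆ α`, where `ν` contains the approximations of all elements of `I` and `J`. -/
theorem trace_mul {α γ ν : (Submodule A B)ˣ} (hα : α ≤ 1) (hγ : γ ≤ 1) (hν : 1 ≤ ν)
    (hI : trace I 1 le_rfl ≤ ν) (hJ : trace J 1 le_rfl ≤ ν) (h : γ ≤ α * ν⁻¹) :
    trace I γ hγ * trace J γ hγ ⊔ α = trace (I * J) α hα := by
  have hαν : α * ν⁻¹ ≤ 1 := by
    rw [mul_inv_le_iff_le_mul, one_mul]
    exact hα.trans hν
  have key : ∀ {φ ψ : ResRing (Residue A)} {b c : B}, φ ∈ I → ψ ∈ J → IsApprox φ b γ →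
      IsApprox ψ c γ → IsApprox (φ * ψ) (b * c) α := by
    intro φ ψ b c hφ hψ hb hc
    exact IsApprox.mul hν hα (hI ⟨φ, hφ, hb.mono hγ le_rfl⟩) (hJ ⟨ψ, hψ, hc.mono hγ le_rfl⟩)
      (hb.mono h hαν) (hc.mono h hαν)
  apply le_antisymm
  · refine sup_le (Submodule.mul_le.2 ?_) le_trace
    rintro b ⟨φ, hφ, hb⟩ c ⟨ψ, hψ, hc⟩
    exact ⟨φ * ψ, Submodule.mul_mem_mul hφ hψ, key hφ hψ hb hc⟩
  · refine trace_le_iff.2 ⟨_root_.le_sup_right, Submodule.mul_le.2 fun φ hφ ψ hψ => ?_⟩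
    obtain ⟨b, hb⟩ := exists_isApprox φ hγ
    obtain ⟨c, hc⟩ := exists_isApprox ψ hγ
    exact ⟨b * c, Submodule.mem_sup_left (Submodule.mul_mem_mul ⟨φ, hφ, hb⟩ ⟨ψ, hψ, hc⟩),
      key hφ hψ hb hc⟩

theorem exists_foldr_wVal (l : List (ResRing (Residue A))) (γ : (Submodule A B)ˣ) (hγ : γ ≤ 1) :
    ∃ η : (Submodule A B)ˣ,
      (l.map (fun φ => wVal φ (posOf γ hγ))).foldr (· + ·) (posOf γ hγ).1 = mk 0 η ∧
      (η : Submodule A B) = trace (Submodule.span _ {φ | φ ∈ l}) γ hγ := by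
  -- `η` is determined by the submodules that contain it.
  suffices H : ∃ η : (Submodule A B)ˣ,
      (l.map (fun φ => wVal φ (posOf γ hγ))).foldr (· + ·) (posOf γ hγ).1 = mk 0 η ∧
      ∀ N : Submodule A B, (η : Submodule A B) ≤ N ↔
        (γ : Submodule A B) ≤ N ∧ ∀ φ ∈ l, φ ∈ liftSub N γ hγ by
    obtain ⟨η, h1, h2⟩ := H
    refine ⟨η, h1, eq_of_forall_ge_iff fun N => ?_⟩
    rw [h2, trace_le_iff, Submodule.span_le]
    rfl
  induction l with
  | nil => exact ⟨γ, rfl, fun N => by simp⟩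
  | cons φ l ih =>
    obtain ⟨η, h1, h2⟩ := ih
    obtain ⟨b, hb⟩ := exists_isApprox φ hγ
    refine ⟨addGen γ b ⊔ η, ?_, fun N => ?_⟩
    · rw [List.map_cons, List.foldr_cons, h1, wVal, hb.2, qv_mk, add_mk, add_zero]
    · rw [coe_sup, sup_le_iff, h2, coe_addGen, sup_le_iff, Submodule.span_singleton_le_iff_mem,
        List.forall_mem_cons]
      constructor
      · rintro ⟨⟨h3, h4⟩, -, h5⟩
        exact ⟨h3, ⟨b, h4, hb⟩, h5⟩
      · rintro ⟨h3, ⟨c, hc, hc'⟩, h5⟩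
        refine ⟨⟨h3, ?_⟩, h3, h5⟩
        rw [← sub_add_cancel b c]
        exact N.add_mem (h3 (hc'.congr_iff.1 hb)) hc

theorem exists_isWHat (hI : I.FG) : ∃ f, IsWHat I f := by
  obtain ⟨s, rfl⟩ := hI
  refine ⟨_, s.toList, ?_, fun α => rfl⟩
  congr 1
  ext φ
  simp

/-- The map `ŵ(I)` does not depend on the choice of generators of `I`: its values are the traces
of `I`. -/
theorem isWHat_iff {f : PosIdem (Residue A) → Residue A} :
    IsWHat I f ↔ I.FG ∧ ∀ (γ : (Submodule A B)ˣ) (hγ : γ ≤ 1), ∃ η : (Submodule A B)ˣ,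
      f (posOf γ hγ) = mk 0 η ∧ (η : Submodule A B) = trace I γ hγ := by
  have key : ∀ {f : PosIdem (Residue A) → Residue A}, IsWHat I f →
      I.FG ∧ ∀ (γ : (Submodule A B)ˣ) (hγ : γ ≤ 1), ∃ η : (Submodule A B)ˣ,
        f (posOf γ hγ) = mk 0 η ∧ (η : Submodule A B) = trace I γ hγ := by
    rintro f ⟨l, rfl, hf⟩
    refine ⟨Submodule.fg_span (List.finite_toSet l), fun γ hγ => ?_⟩
    rw [hf]
    exact exists_foldr_wVal l γ hγ
  refine ⟨key, ?_⟩
  rintro ⟨hI, h⟩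
  obtain ⟨g, hg⟩ := exists_isWHat hI
  have hfg : f = g := by
    funext α
    obtain ⟨γ, hγ, rfl⟩ := exists_posOf α
    obtain ⟨η, h1, h2⟩ := h γ hγ
    obtain ⟨θ, h3, h4⟩ := (key hg).2 γ hγ
    rw [h1, h3, Units.ext (h2.trans h4.symm)]
  rwa [hfg]

theorem exists_trace_bound (hI : I.FG) (hJ : J.FG) : ∃ ν : (Submodule A B)ˣ, 1 ≤ ν ∧
    trace I 1 le_rfl ≤ ν ∧ trace J 1 le_rfl ≤ ν := by
  obtain ⟨f, hf⟩ := exists_isWHat hI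
  obtain ⟨g, hg⟩ := exists_isWHat hJ
  obtain ⟨η, -, hη⟩ := (isWHat_iff.1 hf).2 1 le_rfl
  obtain ⟨θ, -, hθ⟩ := (isWHat_iff.1 hg).2 1 le_rfl
  refine ⟨η ⊔ θ, ?_, ?_, ?_⟩
  · refine _root_.le_trans ?_ le_sup_left
    rw [← Units.val_le_val, hη]
    exact le_trace
  · rw [← hη]
    exact Units.val_le_val.2 le_sup_left
  · rw [← hθ]
    exact Units.val_le_val.2 le_sup_right

theorem hatIota_posOf (δ γ : (Submodule A B)ˣ) (hγ : γ ≤ 1) (h : mk 0 δ + mk 0 δ = mk 0 δ) :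
    hatIota (Residue A) ⟨mk 0 δ, h⟩ (posOf γ hγ) = mk 0 (δ ⊔ γ) := by
  change mk 0 δ + mk 0 γ = _
  rw [add_mk, add_zero]

theorem hatIota_eps (γ : (Submodule A B)ˣ) (hγ : γ ≤ 1) :
    hatIota (Residue A) ⟨eps, QS.eps_add⟩ (posOf γ hγ) = mk 0 1 :=
  (hatIota_posOf 1 γ hγ QS.eps_add).trans (by rw [sup_eq_left.2 hγ])

theorem isHatMul_of_mul_eq_one {f g : PosIdem (Residue A) → Residue A} (hf : IsWHat I f)
    (hg : IsWHat J g) (h : I * J = 1) :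
    IsHatMul f g (hatIota (Residue A) ⟨eps, QS.eps_add⟩) := by
  obtain ⟨hI, hf⟩ := isWHat_iff.1 hf
  obtain ⟨hJ, hg⟩ := isWHat_iff.1 hg
  obtain ⟨ν, hν, hIν, hJν⟩ := exists_trace_bound hI hJ
  intro α
  obtain ⟨α, hα, rfl⟩ := exists_posOf α
  have hαν : α * ν⁻¹ ≤ 1 := by
    rw [mul_inv_le_iff_le_mul, one_mul]
    exact hα.trans hν
  refine ⟨posOf _ hαν, fun γ hγ => ?_⟩
  obtain ⟨γ, hγ1, rfl⟩ := exists_posOf γ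
  obtain ⟨η, h1, h2⟩ := hf γ hγ1
  obtain ⟨θ, h3, h4⟩ := hg γ hγ1
  rw [hatIota_eps, h1, h3, mk_zero_mul]
  change _ = _ + mk 0 α
  rw [add_mk, add_zero, mk_zero_inj]
  apply Units.ext
  have := trace_mul hα hγ1 hν hIν hJν (posOf_le.1 hγ)
  rw [h, trace_one] at this
  rw [coe_sup, Units.val_mul, h2, h4, this, Units.val_one]

/-- An invertible `A_w`-submodule `I` is determined by `ŵ(I)`: if `ŵ(I) = ŵ(J)`, then
`ŵ(I J⁻¹) = ŵ(J J⁻¹) = ε`, hence `I J⁻¹ ⊆ A_w`. -/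
theorem le_of_isWHat {I J : (Submodule (valSubring (Residue A)) (ResRing (Residue A)))ˣ}
    {f : PosIdem (Residue A) → Residue A}
    (hI : IsWHat (I : Submodule (valSubring (Residue A)) (ResRing (Residue A))) f)
    (hJ : IsWHat (J : Submodule (valSubring (Residue A)) (ResRing (Residue A))) f) :
    (I : Submodule (valSubring (Residue A)) (ResRing (Residue A))) ≤ J := by
  have htr : ∀ (γ : (Submodule A B)ˣ) (hγ : γ ≤ 1), trace I.1 γ hγ = trace J.1 γ hγ := by
    intro γ hγ
    obtain ⟨η, h1, h2⟩ := (isWHat_iff.1 hI).2 γ hγ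
    obtain ⟨θ, h3, h4⟩ := (isWHat_iff.1 hJ).2 γ hγ
    rw [← h2, ← h4, mk_zero_inj.1 (h1.symm.trans h3)]
  obtain ⟨ν, hν, h1, h2⟩ := exists_trace_bound (Submodule.fg_unit I) (Submodule.fg_unit J⁻¹)
  have hν' : 1 * ν⁻¹ ≤ 1 := by rwa [one_mul, inv_le_one']
  have h3 := trace_mul le_rfl hν' hν h1 h2 le_rfl
  rw [htr] at h1 h3
  rw [trace_mul le_rfl hν' hν h1 h2 le_rfl, Units.mul_inv, trace_one] at h3
  have h4 : (I : Submodule (valSubring (Residue A)) (ResRing (Residue A))) * (J⁻¹ :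
      (Submodule (valSubring (Residue A)) (ResRing (Residue A)))ˣ) ≤ 1 := by
    intro φ hφ
    obtain ⟨b, hb⟩ := exists_isApprox φ (le_refl (1 : (Submodule A B)ˣ))
    have h5 : b ∈ (1 : Submodule A B) := by
      rw [h3]
      exact ⟨φ, hφ, hb⟩
    exact mem_one_iff_mem.2 (hb.mem_valSubring.2 (mem_one_iff_mem.1 h5))
  have h5 := mul_le_mul' h4
    (le_refl (J : Submodule (valSubring (Residue A)) (ResRing (Residue A))))
  rwa [mul_assoc, Units.inv_mul, mul_one, one_mul] at h5

end Trace

/-! ### Extension of submodules to the completion -/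

/-- The extension `δ ↦ δ A_w` of `A`-submodules of `B` to `A_w`-submodules of the completion. -/
noncomputable def extend (A : Subring B) [IsPruferExtension A] :
    Submodule A B →* Submodule (valSubring (Residue A)) (ResRing (Residue A)) where
  toFun δ := Submodule.span _ (ofBase A '' δ)
  map_one' := by
    apply le_antisymm
    · rw [Submodule.span_le]
      rintro _ ⟨b, hb, rfl⟩
      exact mem_one_iff_mem.2 (ofBase_mem_valSubring.2 (mem_one_iff_mem.1 hb))
    · rw [Submodule.one_le]
      exact Submodule.subset_span ⟨1, Submodule.one_le.1 le_rfl, map_one _⟩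
  map_mul' δ δ' := by
    apply le_antisymm
    · rw [Submodule.span_le]
      rintro _ ⟨x, hx, rfl⟩
      refine Submodule.mul_induction_on (C := fun x => ofBase A x ∈ _) hx
        (fun b hb c hc => ?_) (fun b c hb hc => ?_)
      · rw [map_mul]
        exact Submodule.mul_mem_mul (Submodule.subset_span ⟨b, hb, rfl⟩)
          (Submodule.subset_span ⟨c, hc, rfl⟩)
      · rw [map_add]
        exact Submodule.add_mem _ hb hc
    · rw [Submodule.span_mul_span, Submodule.span_le]
      rintro _ ⟨_, ⟨b, hb, rfl⟩, _, ⟨c, hc, rfl⟩, rfl⟩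
      exact Submodule.subset_span ⟨b * c, Submodule.mul_mem_mul hb hc, map_mul _ _ _⟩

theorem ofBase_mem_extend {δ : Submodule A B} {b : B} (hb : b ∈ δ) : ofBase A b ∈ extend A δ :=
  Submodule.subset_span ⟨b, hb, rfl⟩

theorem trace_extend (δ : Submodule A B) {γ : (Submodule A B)ˣ} {hγ : γ ≤ 1} :
    trace (extend A δ) γ hγ = δ ⊔ γ := by
  apply le_antisymm
  · refine trace_le_iff.2 ⟨_root_.le_sup_right, Submodule.span_le.2 ?_⟩
    rintro _ ⟨b, hb, rfl⟩
    exact ⟨b, Submodule.mem_sup_left hb, isApprox_ofBase b hγ⟩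
  · refine sup_le (fun b hb => ?_) le_trace
    exact ⟨ofBase A b, ofBase_mem_extend hb, isApprox_ofBase b hγ⟩

theorem isWHat_extend (δ : (Submodule A B)ˣ) (h : mk 0 δ + mk 0 δ = mk 0 δ) :
    IsWHat (Units.map (extend A) δ :
      Submodule (valSubring (Residue A)) (ResRing (Residue A)))
      (hatIota (Residue A) ⟨mk 0 δ, h⟩) := by
  refine isWHat_iff.2 ⟨Submodule.fg_unit _, fun γ hγ => ⟨δ ⊔ γ, hatIota_posOf δ γ hγ h, ?_⟩⟩
  exact (trace_extend (δ : Submodule A B)).symm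

/-! ### The strong Prüfer–Manis property -/

/-- If `ŵ(I)` is invertible with inverse `ŵ(J)`, then `ŵ(I)(γ) ŵ(J)(γ) = A` for all large `γ`, and
as `ŵ(I)(γ)` and `ŵ(J)(γ)` decrease with growing precision, `ŵ(I)(γ)` is eventually constant. -/
theorem exists_eq_hatIota {f : PosIdem (Residue A) → Residue A}
    (hf : f ∈ wHatUnits (Residue A)) :
    ∃ (δ : (Submodule A B)ˣ) (h : (mk 0 δ : Residue A) + mk 0 δ = mk 0 δ),
      hatIota (Residue A) ⟨mk 0 δ, h⟩ = f := by
  obtain ⟨⟨I, hI⟩, g, ⟨J, hJ⟩, hfg⟩ := hf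
  choose F hF hF' using (isWHat_iff.1 hI).2
  choose G hG hG' using (isWHat_iff.1 hJ).2
  have hFmono : ∀ {γ δ : (Submodule A B)ˣ} (hγ : γ ≤ 1) (hδ : δ ≤ 1), δ ≤ γ → F δ hδ ≤ F γ hγ := by
    intro γ δ hγ hδ h
    rw [← Units.val_le_val, hF', hF']
    exact trace_mono h
  have hGmono : ∀ {γ δ : (Submodule A B)ˣ} (hγ : γ ≤ 1) (hδ : δ ≤ 1), δ ≤ γ → G δ hδ ≤ G γ hγ := by
    intro γ δ hγ hδ h
    rw [← Units.val_le_val, hG', hG']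
    exact trace_mono h
  have hmul : ∀ α : (Submodule A B)ˣ, α ≤ 1 → ∃ γ₀ : (Submodule A B)ˣ, γ₀ ≤ 1 ∧
      ∀ γ (hγ : γ ≤ 1), γ ≤ γ₀ → F γ hγ * G γ hγ ⊔ α = 1 := by
    intro α hα
    obtain ⟨γ₀, h⟩ := hfg (posOf α hα)
    obtain ⟨γ₀, h0, rfl⟩ := exists_posOf γ₀
    refine ⟨γ₀, h0, fun γ hγ hle => ?_⟩
    have h1 := h (posOf γ hγ) (posOf_le.2 hle)
    rw [hatIota_eps, hF, hG, mk_zero_mul] at h1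
    change _ = _ + mk 0 α at h1
    rw [add_mk, add_zero, mk_zero_inj] at h1
    exact h1.symm
  obtain ⟨γ₁, hγ₁, h1⟩ := hmul 1 le_rfl
  have hone : ∀ γ (hγ : γ ≤ 1), γ ≤ γ₁ → F γ hγ * G γ hγ = 1 := by
    intro γ hγ hle
    -- Test the product at the precision `ŵ(I)(γ) ŵ(J)(γ) ⊆ A` itself.
    have h2 : F γ hγ * G γ hγ ≤ 1 := sup_eq_right.1 (h1 γ hγ hle)
    obtain ⟨γ₂, hγ₂, h3⟩ := hmul _ h2
    have h4 : γ ⊓ γ₂ ≤ 1 := inf_le_left.trans hγ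
    have h5 := h3 (γ ⊓ γ₂) h4 inf_le_right
    rwa [sup_eq_right.2 (mul_le_mul' (hFmono hγ h4 inf_le_left)
      (hGmono hγ h4 inf_le_left))] at h5
  refine ⟨F γ₁ hγ₁, mk_add_self.2 (Submodule.zero_mem _), ?_⟩
  funext α
  obtain ⟨γ, hγ, rfl⟩ := exists_posOf α
  have h2 : γ ⊓ γ₁ ≤ 1 := inf_le_left.trans hγ
  have h3 : F (γ ⊓ γ₁) h2 = F γ₁ hγ₁ := by
    apply le_antisymm (hFmono _ _ inf_le_right)
    rw [eq_inv_iff_mul_eq_one.2 (hone _ h2 inf_le_right),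
      eq_inv_iff_mul_eq_one.2 (hone γ₁ hγ₁ le_rfl)]
    exact inv_le_inv' (hGmono _ _ inf_le_right)
  rw [hatIota_posOf, hF, mk_zero_inj, ← h3]
  apply Units.ext
  rw [coe_sup, hF', hF', trace_sup inf_le_left]

theorem isPruferManisStrong : IsPruferManisStrong (Residue A) where
  prufer := isPruferExtension_valSubring
  units_eq := by
    apply Set.Subset.antisymm
    · intro f hf
      obtain ⟨δ, h, rfl⟩ := exists_eq_hatIota hf
      exact ⟨_, rfl⟩
    · rintro _ ⟨⟨δ, h⟩, rfl⟩
      obtain ⟨δ, rfl⟩ := add_idem_iff.1 h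
      have h' : (mk 0 δ⁻¹ : Residue A) + mk 0 δ⁻¹ = mk 0 δ⁻¹ :=
        mk_add_self.2 (Submodule.zero_mem _)
      refine ⟨⟨_, isWHat_extend δ h⟩, _, ⟨_, isWHat_extend δ⁻¹ h'⟩,
        isHatMul_of_mul_eq_one (isWHat_extend δ h) (isWHat_extend δ⁻¹ h') ?_⟩
      rw [map_inv, Units.mul_inv]
  mapsTo I := by
    obtain ⟨f, hf⟩ := exists_isWHat (Submodule.fg_unit I)
    obtain ⟨g, hg⟩ := exists_isWHat (Submodule.fg_unit I⁻¹)
    exact ⟨f, ⟨⟨_, hf⟩, g, ⟨_, hg⟩, isHatMul_of_mul_eq_one hf hg (Units.mul_inv I)⟩, hf⟩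
  bijective f hf := by
    obtain ⟨δ, h, rfl⟩ := exists_eq_hatIota hf
    refine ⟨Units.map (extend A) δ, isWHat_extend δ h, fun J hJ => ?_⟩
    exact Units.ext (le_antisymm (le_of_isWHat hJ (isWHat_extend δ h))
      (le_of_isWHat (isWHat_extend δ h) hJ))

end Residue

theorem lemma7p1 {B : Type*} [CommRing B] (A : Subring B) [IsPruferExtension A] :
    ∃ _ : IsSuperrigidQSring (Residue A),
      IsSphericallyComplete (Residue A) ∧
      IsPruferManisStrong (Residue A) ∧
      IsLFF (Residue A) ∧
      IsMedianQSring (Residue A) ∧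
      ∀ (x₁ x₂ x₃ : B) (α₁ α₂ α₃ : (Submodule A B)ˣ),
        ∃ α : (Submodule A B)ˣ,
          (α : Submodule A B) =
            (Residue.pairModulus x₁ x₂ α₁ α₂ : Submodule A B) ⊓
              (Residue.pairModulus x₁ x₃ α₁ α₃ : Submodule A B) ⊓
              (Residue.pairModulus x₂ x₃ α₂ α₃ : Submodule A B) ∧
          ∃ x : B,
            Residue.MedianCongr x₁ x₂ x₃ α₁ α₂ α₃ x ∧
            (∀ y : B, Residue.MedianCongr x₁ x₂ x₃ α₁ α₂ α₃ y ↔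
              Residue.mk y α = Residue.mk x α) ∧
            IsJoin {meet (Residue.mk x₁ α₁) (Residue.mk x₂ α₂),
                meet (Residue.mk x₁ α₁) (Residue.mk x₃ α₃),
                meet (Residue.mk x₂ α₂) (Residue.mk x₃ α₃)} (Residue.mk x α) ∧
            IsMedianPoint (Residue.mk x₁ α₁) (Residue.mk x₂ α₂) (Residue.mk x₃ α₃)
              (Residue.mk x α) := by
  refine ⟨inferInstance, Residue.isSphericallyComplete, Residue.isPruferManisStrong,
    Residue.isLFF, Residue.isMedianQSring, fun x₁ x₂ x₃ α₁ α₂ α₃ => ?_⟩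
  obtain ⟨x, hx⟩ := Residue.exists_medianCongr x₁ x₂ x₃ α₁ α₂ α₃
  refine ⟨_, ?_, x, hx, fun y => ?_, Residue.isJoin_of_medianCongr hx,
    Residue.isMedianPoint_of_medianCongr hx⟩
  · rw [Residue.coe_inf, Residue.coe_inf]
  · rw [Residue.medianCongr_iff hx, Residue.mk_eq_mk]
    exact (and_iff_right rfl).symm
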